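/- Conventions. Let $\mathcal L$ be a first-order language containing a binary relation symbol $<$. All structures below are finite nonempty $\mathcal L$-structures in which $<$ is a linear order; $(a,b)$ denotes an open interval, where the end points may be elements of $M$ or $\pm\infty$ when we speak of cells, and $|X|$ is the number of elements of $X$. A class $\mathcal C$ of such structures is an $\mathcal O$-asymptotic class if for every $m\in\mathbb N$ and every $\mathcal L$-formula $\varphi(x;y_1,\dots,y_m)$ in one variable $x$ there are a constant $C_\varphi>0$, a number $k_\varphi\ge 1$, a finite set $E_\varphi\subseteq[0,1]^{k_\varphi}$ and, for each $\bar\mu\in E_\varphi$, an $\mathcal L$-formula $\varphi_{\bar\mu}(\bar y;z_1,\dots,z_{k_\varphi})$ (the $\bar\mu$-definition for $\varphi$) such that for all $M\in\mathcal C$ and $\bar a\in M^m$: (1) there are $\bar\mu\in E_\varphi$ and $\min M=c_0\le c_1\le\dots\le c_{k_\varphi}=\max M$ in $M$ with $M\models\varphi_{\bar\mu}(\bar a;c_1,\dots,c_{k_\varphi})$, such that for each $i=1,\dots,k_\varphi$ either $\mu_i=0$ and $|\varphi(M;\bar a)\cap(c_{i-1},c_i)|\le C_\varphi$, or $\mu_i>0$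 and $\bigl||\varphi(M;\bar a)\cap(u,v)|-\mu_i|(u,v)|\bigr|\le C_\varphi|(u,v)|^{1/2}$ for all $(u,v)\subseteq(c_{i-1},c_i)$ with $u,v\in M$; (2) whenever $\bar\mu\in E_\varphi$, $\min M=c_0\le c_1\le\dots\le c_{k_\varphi}=\max M$ and $M\models\varphi_{\bar\mu}(\bar a;c_1,\dots,c_{k_\varphi})$, this alternative holds for each $i$. Fix an $\mathcal O$-asymptotic class $\mathcal C$ together with a choice of such $C_\varphi,k_\varphi,E_\varphi,\varphi_{\bar\mu}$. For $M\in\mathcal C$ the $\mathcal C$-cells are defined inductively. (a) A nonempty interval $(a,b)\subseteq M$ with $a,b\in M\cup\{\pm\infty\}$ is a $(1)$-$\mathcal C$-cell. (b) If $X\subseteq M^n$ is an $(i_1,\dots,i_n)$-$\mathcal C$-cell, $\varphi_{\bar\mu}(\bar y;\bar z)$ with $|\bar y|=n$ is the $\bar\mu$-definition for some formula $\varphi(x;\bar y)$ and $\bar\mu\in E_\varphi$, and $\bar d$ is a tuple from $M$, then $X\cap\varphi_{\bar\mu}(M^n;\bar d)$, if nonempty, is an $(i_1,\dots,i_n)$-$\mathcal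 C$-cell. (c) If $X\subseteq M^n$ is an $(i_1,\dots,i_n)$-$\mathcal C$-cell and $f,g:M^n\to M$ are definable with parameters, then $\{(\bar x,f(\bar x)):\bar x\in X\}$ is an $(i_1,\dots,i_n,0)$-$\mathcal C$-cell, and, if $f<g$ on $X$, $\{(\bar x,y):\bar x\in X,\ f(\bar x)<y<g(\bar x)\}$ is an $(i_1,\dots,i_n,1)$-$\mathcal C$-cell. The dimension $\dim Z$ of a $\mathcal C$-cell $Z$ is the least value of $i_1+\dots+i_n$ over all $(i_1,\dots,i_n)$ such that $Z$ is an $(i_1,\dots,i_n)$-$\mathcal C$-cell. A set $Y\subseteq M^n$ is a $1$-cell if some coordinate projection maps $Y$ bijectively onto a nonempty interval $(a,b)$ of $M$, $a,b\in M\cup\{\pm\infty\}$. A cell decomposition of $M^n$ into $Z_1,\dots,Z_k$ means that the $Z_i$ are pairwise disjoint with union $M^n$ and each nonempty $Z_i$ is a $\mathcal C$-cell (some of the $Z_i$ may be empty). Theorem. Let $\mathcal C$ be an $\mathcal O$-asymptotic class, with a choice as above. Then for all $n\ge1$, $m\ge 0$ and every $\mathcal L$-formula $\varphi(\bar x;\bar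 y)$ with $|\bar x|=n$, $|\bar y|=m$ there are a constant $C>0$, a number $k$, a finite set $D\subseteq[0,1]^k$ and, for each $\bar\alpha\in D$, $\mathcal L$-formulas $\psi_{\bar\alpha}(\bar y;\bar z)$ and $Z^{\bar\alpha}_1(\bar x;\bar y,\bar z),\dots,Z^{\bar\alpha}_k(\bar x;\bar y,\bar z)$ with the following properties. For $\bar\alpha\in D$, $M\in\mathcal C$ and tuples $\bar a,\bar d$ from $M$, write $Z_i=Z_i^{\bar\alpha}(M^n;\bar a,\bar d)$ and consider the condition $(*)$ for every $i\le k$ with $Z_i\ne\emptyset$, either $\alpha_i=0$ and $|\varphi(M^n;\bar a)\cap Z_i|\le C$, or $\alpha_i\ne0$ and $\bigl||\varphi(M^n;\bar a)\cap Z_i|-\alpha_i|Z_i|\bigr|\le C|L_i|^{\dim Z_i-1/2}$, where $L_i$ is a $1$-cell of maximal size contained in $Z_i$. 1. For every $M\in\mathcal C$ and $\bar a\in M^m$ there are $\bar\alpha\in D$ and $\bar d$ such that $Z_1,\dots,Z_k$ is a cell decomposition of $M^n$ and $(*)$ holds. 2. For every $\bar\alpha\in D$, $M\in\mathcal C$,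 $\bar a\in M^m$ and $\bar d$: $M\models\psi_{\bar\alpha}(\bar a;\bar d)$ if and only if $Z_1,\dots,Z_k$ is a cell decomposition of $M^n$ and $(*)$ holds. -/

import Mathlib

universe u v w

/-- A finite (nonempty) linearly ordered structure in a language `L` with a distinguished binary
relation symbol `lt`, interpreted as the strict linear order. -/
structure FinOrdStructure (L : FirstOrder.Language.{u, v}) (lt : L.Relations 2) where
  carrier : Type w
  [str : L.Structure carrier]
  [ord : LinearOrder carrier]
  [fin : Finite carrier]
  [nonempty : Nonempty carrier]
  lt_iff : ∀ x y : carrier, FirstOrder.Language.Structure.RelMap lt ![x, y] ↔ x < y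

attribute [instance] FinOrdStructure.str FinOrdStructure.ord FinOrdStructure.fin
  FinOrdStructure.nonempty

namespace FinOrdStructure

variable {L : FirstOrder.Language.{u, v}} {lt : L.Relations 2}

instance : CoeSort (FinOrdStructure.{u, v, w} L lt) (Type w) := ⟨FinOrdStructure.carrier⟩

end FinOrdStructure

/-- The set `φ(M^n; a)` defined in `M` by the formula `φ(x;y)` with parameters `a`. -/
def defSet {L : FirstOrder.Language.{u, v}} (M : Type w) [L.Structure M] {n : ℕ} {γ : Type}
    (φ : L.Formula (Fin n ⊕ γ)) (a : γ → M) : Set (Fin n → M) :=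
  {x | φ.Realize (Sum.elim x a)}

/-- The subset `φ(M; a)` of `M` defined by a formula in one variable `x`. -/
def defSet₁ {L : FirstOrder.Language.{u, v}} (M : Type w) [L.Structure M] {m : ℕ}
    (φ : L.Formula (Fin 1 ⊕ Fin m)) (a : Fin m → M) : Set M :=
  {x | φ.Realize (Sum.elim (fun _ => x) a)}

/-! ### Asymptotic classes of ordered structures -/

/-- The data attached to a formula `φ(x; y₁, …, y_m)`: a constant `C`, a number `k`, a finite
set `E` of measure tuples, and for each `μ ∈ E` the `μ`-definition `φ_μ(y; z₁, …, z_k)`. -/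
structure MeasureData (L : FirstOrder.Language.{u, v}) (m : ℕ) where
  C : ℝ
  k : ℕ
  E : Finset (Fin k → ℝ)
  defn : (Fin k → ℝ) → L.Formula (Fin m ⊕ Fin k)
  C_pos : 0 < C
  k_pos : 1 ≤ k
  E_mem : ∀ μ ∈ E, ∀ i, μ i ∈ Set.Icc (0 : ℝ) 1

/-- `c₀ = min M ≤ c₁ ≤ ⋯ ≤ c_k = max M`. -/
def IsSubdivision {M : Type w} [LinearOrder M] {k : ℕ} (c : Fin (k + 1) → M) : Prop :=
  Monotone c ∧ IsLeast Set.univ (c 0) ∧ IsGreatest Set.univ (c (Fin.last k))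

/-- On each `(c_{i-1}, c_i)` the set `S` either has measure `μ_i = 0` and at most `C` elements,
or it has measure `μ_i > 0` and is uniformly distributed on all subintervals. -/
def UniformlyDistributed {M : Type w} [LinearOrder M] (S : Set M) (C : ℝ) {k : ℕ}
    (μ : Fin k → ℝ) (c : Fin (k + 1) → M) : Prop :=
  ∀ i : Fin k,
    (μ i = 0 ∧ ((S ∩ Set.Ioo (c i.castSucc) (c i.succ)).ncard : ℝ) ≤ C) ∨
    (0 < μ i ∧ ∀ p q : M, Set.Ioo p q ⊆ Set.Ioo (c i.castSucc) (c i.succ) →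
      |((S ∩ Set.Ioo p q).ncard : ℝ) - μ i * ((Set.Ioo p q).ncard : ℝ)|
        ≤ C * ((Set.Ioo p q).ncard : ℝ) ^ (1 / 2 : ℝ))

/-- A choice of measure data for all formulas `φ(x; y₁, …, y_m)`, `m ∈ ℕ`. -/
abbrev MeasureSystem (L : FirstOrder.Language.{u, v}) : Type (max u v) :=
  ∀ m : ℕ, L.Formula (Fin 1 ⊕ Fin m) → MeasureData L m

/-- The measure system `Δ` witnesses that `𝒞` is an `𝒪`-asymptotic class: every `φ(M; a)` has a
subdivision and a measure tuple selected by the `μ`-definition, and everything which the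
`μ`-definition selects is a correct decomposition. -/
def MeasureSystem.Witnesses {L : FirstOrder.Language.{u, v}} {lt : L.Relations 2} (Δ : MeasureSystem L)
    (𝒞 : Set (FinOrdStructure.{u, v, w} L lt)) : Prop :=
  ∀ (m : ℕ) (φ : L.Formula (Fin 1 ⊕ Fin m)), ∀ M ∈ 𝒞, ∀ a : Fin m → M,
    (∃ c : Fin ((Δ m φ).k + 1) → M, ∃ μ ∈ (Δ m φ).E,
      IsSubdivision c ∧
      UniformlyDistributed (defSet₁ M φ a) (Δ m φ).C μ c ∧
      ((Δ m φ).defn μ).Realize (Sum.elim a (fun i => c i.succ))) ∧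
    (∀ μ ∈ (Δ m φ).E, ∀ c : Fin ((Δ m φ).k + 1) → M, IsSubdivision c →
      ((Δ m φ).defn μ).Realize (Sum.elim a (fun i => c i.succ)) →
      UniformlyDistributed (defSet₁ M φ a) (Δ m φ).C μ c)

/-- `𝒞` is an `𝒪`-asymptotic class. -/
def IsOAsymptotic {L : FirstOrder.Language.{u, v}} {lt : L.Relations 2}
    (𝒞 : Set (FinOrdStructure.{u, v, w} L lt)) : Prop :=
  ∃ Δ : MeasureSystem L, Δ.Witnesses 𝒞

/-! ### Cells -/

/-- `I` is a nonempty open interval `(a, b)` with endpoints in `M ∪ {-∞, ∞}`. -/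
def IsOpenInterval {M : Type w} [LinearOrder M] (I : Set M) : Prop :=
  I.Nonempty ∧ ((∃ a b, I = Set.Ioo a b) ∨ (∃ b, I = Set.Iio b) ∨ (∃ a, I = Set.Ioi a) ∨
    I = Set.univ)

/-- `f : M^n → M` is definable with parameters. -/
def IsDefinableFun (L : FirstOrder.Language.{u, v}) {M : Type w} [L.Structure M] {n : ℕ}
    (f : (Fin n → M) → M) : Prop :=
  (Set.univ : Set M).Definable L {p : Fin (n + 1) → M | p (Fin.last n) = f (Fin.init p)}

/-- `IsCell Δ M ι Z`: the set `Z ⊆ M^n` is an `(ι₁, …, ι_n)`-`𝒞`-cell, where the `μ`-definitions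
are those of the measure system `Δ`. -/
inductive IsCell {L : FirstOrder.Language.{u, v}} (Δ : MeasureSystem L) (M : Type w) [L.Structure M]
    [LinearOrder M] : {n : ℕ} → (Fin n → Fin 2) → Set (Fin n → M) → Prop
  | interval (I : Set M) (hI : IsOpenInterval I) :
      IsCell Δ M (n := 1) (fun _ => 1) {x | x 0 ∈ I}
  | inter {n : ℕ} {ι : Fin n → Fin 2} {X : Set (Fin n → M)} (hX : IsCell Δ M ι X)
      (φ : L.Formula (Fin 1 ⊕ Fin n)) (μ : Fin (Δ n φ).k → ℝ) (hμ : μ ∈ (Δ n φ).E)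
      (d : Fin (Δ n φ).k → M) (hne : (X ∩ defSet M ((Δ n φ).defn μ) d).Nonempty) :
      IsCell Δ M ι (X ∩ defSet M ((Δ n φ).defn μ) d)
  | graph {n : ℕ} {ι : Fin n → Fin 2} {X : Set (Fin n → M)} (hX : IsCell Δ M ι X)
      (f : (Fin n → M) → M) (hf : IsDefinableFun L f) :
      IsCell Δ M (n := n + 1) (Fin.snoc ι 0)
        {p | Fin.init p ∈ X ∧ p (Fin.last n) = f (Fin.init p)}
  | band {n : ℕ} {ι : Fin n → Fin 2} {X : Set (Fin n → M)} (hX : IsCell Δ M ι X)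
      (f g : (Fin n → M) → M) (hf : IsDefinableFun L f) (hg : IsDefinableFun L g)
      (hfg : ∀ x ∈ X, f x < g x) :
      IsCell Δ M (n := n + 1) (Fin.snoc ι 1)
        {p | Fin.init p ∈ X ∧ f (Fin.init p) < p (Fin.last n) ∧
          p (Fin.last n) < g (Fin.init p)}

/-- The dimension of a cell `Z`: the least `∑ ι_j` over all `ι` such that `Z` is an `ι`-cell. -/
noncomputable def cellDim {L : FirstOrder.Language.{u, v}} (Δ : MeasureSystem L) {M : Type w}
    [L.Structure M] [LinearOrder M] {n : ℕ} (Z : Set (Fin n → M)) : ℕ :=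
  sInf {s | ∃ ι : Fin n → Fin 2, IsCell Δ M ι Z ∧ s = ∑ j, (ι j : ℕ)}

/-- `Z ⊆ M^n` is a 1-cell: some coordinate projection is a bijection of `Z` with an interval. -/
def IsOneCell {M : Type w} [LinearOrder M] {n : ℕ} (Z : Set (Fin n → M)) : Prop :=
  ∃ (j : Fin n) (I : Set M), IsOpenInterval I ∧ Set.BijOn (fun x : Fin n → M => x j) Z I

/-- `Y` is a 1-cell of maximal size contained in `Z`. -/
def IsMaxOneCell {M : Type w} [LinearOrder M] {n : ℕ} (Y Z : Set (Fin n → M)) : Prop :=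
  IsOneCell Y ∧ Y ⊆ Z ∧ ∀ Y' : Set (Fin n → M), IsOneCell Y' → Y' ⊆ Z → Y'.ncard ≤ Y.ncard

/-- `Z₁, …, Z_k` is a partition of `M^n` into at most `k` cells: the members of the family which
are not needed are empty. -/
def IsCellDecomposition {L : FirstOrder.Language.{u, v}} (Δ : MeasureSystem L) {M : Type w}
    [L.Structure M] [LinearOrder M] {n k : ℕ} (Z : Fin k → Set (Fin n → M)) : Prop :=
  (∀ i, (Z i).Nonempty → ∃ ι : Fin n → Fin 2, IsCell Δ M ι (Z i)) ∧
  (∀ i j, i ≠ j → Disjoint (Z i) (Z j)) ∧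
  (⋃ i, Z i) = Set.univ

/-- The measure condition on the subset `S ⊆ M^n`, with constant `C` and measure tuple `α`, along
the family of cells `Z₁, …, Z_k`. -/
def CellwiseMeasure {L : FirstOrder.Language.{u, v}} (Δ : MeasureSystem L) {M : Type w}
    [L.Structure M] [LinearOrder M] {n k : ℕ} (S : Set (Fin n → M)) (C : ℝ) (α : Fin k → ℝ)
    (Z : Fin k → Set (Fin n → M)) : Prop :=
  ∀ i, (Z i).Nonempty →
    (α i = 0 ∧ ((S ∩ Z i).ncard : ℝ) ≤ C) ∨
    (α i ≠ 0 ∧ ∃ Y : Set (Fin n → M), IsMaxOneCell Y (Z i) ∧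
      |((S ∩ Z i).ncard : ℝ) - α i * ((Z i).ncard : ℝ)|
        ≤ C * (Y.ncard : ℝ) ^ ((cellDim Δ (Z i) : ℝ) - 1 / 2))

/-! The proof is an induction on the number of variables, driven by one-variable information made
uniform. By the axioms of the class, a fibre of `φ` in its last variable is controlled by a
subdivision of bounded length. Take as points the subdivision points and the boundedly many elements
of the fibre in parts of measure zero. The gaps that remain are intervals on which the fibre is
empty or has a positive density from a fixed finite list. Such points and end points are given by
fixed formulas: in a finite linear order the lexicographically least solution of a first-order
condition is definable (`UnifDef.exists_choice`), and a density, which is not itself first-order, is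
certified by a `μ`-definition through clause (2).

Which points and densities occur still depends on the parameters. `exists_interval_labelling`
removes this dependence. If `M` is large, some gap is long, and the unused labels for points and for
positive densities receive pieces of one or two elements cut from it; the resulting error is bounded
and goes into the constant. Hence in `exists_fibre_partition` a single list of labels serves all
fibres.

A point label gives a function `h`. Over the graph of `h` the set is a set in one variable less, and
the induction applies. An interval label gives a band between functions `f < g` on which every fibre
has the same density. The base of the band therefore need not be adapted to `φ`, and can be cut into
boxes that project onto the first coordinate. A band of positive density over a box with type sum
`d` contains a 1-cell of size `|M|`, and summing the fibre errors gives at most `|M|^d * C|M|^(1/2)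
= C|M|^((d+1)-1/2)`. Its fibres have at least two elements, so its dimension is exactly `d+1`
(`cellDim_eq_of_thick`). Structures of bounded size are cut into single points. -/

/-! ### Uniformly definable families -/

section UniformDefinability


variable {L : FirstOrder.Language.{u, v}} {lt : L.Relations 2} {γ δ ι : Type}

/-- A relation on `γ`-tuples, given in every finite ordered structure, which is defined by one
formula in all of them. -/
def UnifDef (P : ∀ M : FinOrdStructure.{u, v, w} L lt, (γ → M) → Prop) : Prop :=
  ∃ φ : L.Formula γ, ∀ (M : FinOrdStructure.{u, v, w} L lt) (x : γ → M), φ.Realize x ↔ P M x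

/-- A function on `γ`-tuples whose graph is uniformly definable. -/
def UnifDefFun (F : ∀ M : FinOrdStructure.{u, v, w} L lt, (γ → M) → M) : Prop :=
  UnifDef fun M (x : γ ⊕ Unit → M) => x (.inr ()) = F M (x ∘ Sum.inl)

/-! ### Closure properties of uniform definability -/

namespace UnifDef

variable {P Q : ∀ M : FinOrdStructure.{u, v, w} L lt, (γ → M) → Prop}

theorem congr (hP : UnifDef P) (h : ∀ M x, P M x ↔ Q M x) : UnifDef Q :=
  let ⟨φ, hφ⟩ := hP
  ⟨φ, fun M x => (hφ M x).trans (h M x)⟩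

theorem realize (φ : L.Formula γ) :
    UnifDef fun (_M : FinOrdStructure.{u, v, w} L lt) x => φ.Realize x :=
  ⟨φ, fun _ _ => Iff.rfl⟩

theorem and (hP : UnifDef P) (hQ : UnifDef Q) : UnifDef fun M x => P M x ∧ Q M x :=
  let ⟨φ, hφ⟩ := hP
  let ⟨ψ, hψ⟩ := hQ
  ⟨φ ⊓ ψ, fun M x => by simp [hφ, hψ]⟩

theorem or (hP : UnifDef P) (hQ : UnifDef Q) : UnifDef fun M x => P M x ∨ Q M x :=
  let ⟨φ, hφ⟩ := hP
  let ⟨ψ, hψ⟩ := hQ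
  ⟨φ ⊔ ψ, fun M x => by simp [hφ, hψ]⟩

theorem not (hP : UnifDef P) : UnifDef fun M x => ¬ P M x :=
  let ⟨φ, hφ⟩ := hP
  ⟨φ.not, fun M x => by simp [hφ]⟩

theorem imp (hP : UnifDef P) (hQ : UnifDef Q) : UnifDef fun M x => P M x → Q M x :=
  let ⟨φ, hφ⟩ := hP
  let ⟨ψ, hψ⟩ := hQ
  ⟨φ.imp ψ, fun M x => by simp [hφ, hψ]⟩

theorem const (p : Prop) : UnifDef fun (_ : FinOrdStructure.{u, v, w} L lt) (_ : γ → _) => p := by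
  by_cases hp : p
  · exact ⟨⊤, fun M x => by simp [hp]⟩
  · exact ⟨⊥, fun M x => by simp [hp]⟩

theorem comap {P : ∀ M : FinOrdStructure.{u, v, w} L lt, (δ → M) → Prop} (hP : UnifDef P)
    (e : δ → γ) : UnifDef fun M (x : γ → M) => P M (x ∘ e) :=
  let ⟨φ, hφ⟩ := hP
  ⟨φ.relabel e, fun M x => by simp [hφ]⟩

theorem finite_forall [Finite ι] {P : ι → ∀ M : FinOrdStructure.{u, v, w} L lt, (γ → M) → Prop}
    (hP : ∀ i, UnifDef (P i)) : UnifDef fun M x => ∀ i, P i M x := by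
  choose φ hφ using hP
  exact ⟨FirstOrder.Language.Formula.iInf φ, fun M x => by simp [hφ]⟩

theorem finite_exists [Finite ι] {P : ι → ∀ M : FinOrdStructure.{u, v, w} L lt, (γ → M) → Prop}
    (hP : ∀ i, UnifDef (P i)) : UnifDef fun M x => ∃ i, P i M x := by
  choose φ hφ using hP
  exact ⟨FirstOrder.Language.Formula.iSup φ, fun M x => by simp [hφ]⟩

theorem exists_tuple [Finite ι] {P : ∀ M : FinOrdStructure.{u, v, w} L lt, (γ → M) → (ι → M) → Prop}
    (hP : UnifDef fun M (x : γ ⊕ ι → M) => P M (x ∘ Sum.inl) (x ∘ Sum.inr)) :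
    UnifDef fun M x => ∃ y, P M x y := by
  obtain ⟨φ, hφ⟩ := hP
  exact ⟨FirstOrder.Language.Formula.iExs ι φ, fun M x => by simp [FirstOrder.Language.Formula.realize_iExs, hφ]⟩

theorem forall_tuple [Finite ι] {P : ∀ M : FinOrdStructure.{u, v, w} L lt, (γ → M) → (ι → M) → Prop}
    (hP : UnifDef fun M (x : γ ⊕ ι → M) => P M (x ∘ Sum.inl) (x ∘ Sum.inr)) :
    UnifDef fun M x => ∀ y, P M x y :=
  (exists_tuple (P := fun M x y => ¬ P M x y) hP.not).not.congr fun M x => by simp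

theorem exists_elem {P : ∀ M : FinOrdStructure.{u, v, w} L lt, (γ → M) → M → Prop}
    (hP : UnifDef fun M (x : γ ⊕ Unit → M) => P M (x ∘ Sum.inl) (x (.inr ()))) :
    UnifDef fun M x => ∃ y, P M x y :=
  (exists_tuple (ι := Unit) (P := fun M x y => P M x (y ())) hP).congr fun _ _ =>
    ⟨fun ⟨y, h⟩ => ⟨y (), h⟩, fun ⟨y, h⟩ => ⟨fun _ => y, h⟩⟩

theorem forall_elem {P : ∀ M : FinOrdStructure.{u, v, w} L lt, (γ → M) → M → Prop}
    (hP : UnifDef fun M (x : γ ⊕ Unit → M) => P M (x ∘ Sum.inl) (x (.inr ()))) :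
    UnifDef fun M x => ∀ y, P M x y :=
  (exists_elem (P := fun M x y => ¬ P M x y) hP.not).not.congr fun M x => by simp

/-- Substitution of uniformly definable functions into a uniformly definable relation. -/
theorem subst [Finite δ] {P : ∀ M : FinOrdStructure.{u, v, w} L lt, (δ → M) → Prop} (hP : UnifDef P)
    {F : δ → ∀ M : FinOrdStructure.{u, v, w} L lt, (γ → M) → M} (hF : ∀ d, UnifDefFun (F d)) :
    UnifDef fun M x => P M fun d => F d M x := by
  have h : UnifDef fun M x => ∃ y : δ → M, (∀ d, y d = F d M x) ∧ P M y := by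
    refine exists_tuple (ι := δ) (P := fun M x y => (∀ d, y d = F d M x) ∧ P M y)
      (and (finite_forall fun d => ?_) (hP.comap Sum.inr))
    exact (hF d).comap (Sum.elim Sum.inl fun _ => Sum.inr d)
  refine h.congr fun M x => ⟨?_, fun hx => ⟨_, fun _ => rfl, hx⟩⟩
  rintro ⟨y, hy, hPy⟩
  rwa [← funext hy]

theorem eq_var (i j : γ) : UnifDef fun (_M : FinOrdStructure.{u, v, w} L lt) x => x i = x j :=
  ⟨FirstOrder.Language.Term.equal (FirstOrder.Language.var i) (FirstOrder.Language.var j), fun M x => by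
    simp [FirstOrder.Language.Formula.realize_equal]⟩

theorem lt_var (i j : γ) : UnifDef fun (_M : FinOrdStructure.{u, v, w} L lt) x => x i < x j :=
  ⟨lt.formula₂ (FirstOrder.Language.var i) (FirstOrder.Language.var j), fun M x => by
    simp [FirstOrder.Language.Formula.realize_rel₂, M.lt_iff]⟩

end UnifDef

namespace UnifDefFun

theorem var (i : γ) : UnifDefFun fun (_M : FinOrdStructure.{u, v, w} L lt) x => x i :=
  UnifDef.eq_var _ _

theorem comap {F : ∀ M : FinOrdStructure.{u, v, w} L lt, (δ → M) → M} (hF : UnifDefFun F)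
    (e : δ → γ) : UnifDefFun fun M (x : γ → M) => F M (x ∘ e) :=
  UnifDef.comap hF (Sum.map e id)

variable {F G : ∀ M : FinOrdStructure.{u, v, w} L lt, (γ → M) → M}

theorem rel_eq (hF : UnifDefFun F) (hG : UnifDefFun G) : UnifDef fun M x => F M x = G M x :=
  UnifDef.subst (δ := Fin 2) (P := fun M y => y 0 = y 1) (UnifDef.eq_var 0 1) (F := ![F, G])
    fun d => by fin_cases d <;> assumption

theorem rel_lt (hF : UnifDefFun F) (hG : UnifDefFun G) : UnifDef fun M x => F M x < G M x :=
  UnifDef.subst (δ := Fin 2) (P := fun M y => y 0 < y 1) (UnifDef.lt_var 0 1) (F := ![F, G])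
    fun d => by fin_cases d <;> assumption

theorem rel_le (hF : UnifDefFun F) (hG : UnifDefFun G) : UnifDef fun M x => F M x ≤ G M x :=
  (hG.rel_lt hF).not.congr fun _ _ => not_lt

theorem mem_Ioo {H : ∀ M : FinOrdStructure.{u, v, w} L lt, (γ → M) → M}
    (hH : UnifDefFun H) (hF : UnifDefFun F) (hG : UnifDefFun G) :
    UnifDef fun M x => H M x ∈ Set.Ioo (F M x) (G M x) :=
  (hF.rel_lt hH).and (hH.rel_lt hG)

end UnifDefFun

/-- Uniformly definable choice: a solvable uniformly definable condition on finite tuples has a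
uniformly definable solution, namely the lexicographically least one. -/
theorem UnifDef.exists_choice [Finite ι]
    {P : ∀ M : FinOrdStructure.{u, v, w} L lt, (γ → M) → (ι → M) → Prop}
    (hP : UnifDef fun M (x : γ ⊕ ι → M) => P M (x ∘ Sum.inl) (x ∘ Sum.inr)) :
    ∃ F : ι → ∀ M : FinOrdStructure.{u, v, w} L lt, (γ → M) → M,
      (∀ i, UnifDefFun (F i)) ∧ ∀ M x, (∃ y, P M x y) → P M x fun i => F i M x := by
  classical
  obtain ⟨N, ⟨e⟩⟩ := Finite.exists_equiv_fin ι
  -- Where `P` has no solution every tuple is accepted, so a least tuple always exists and the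
  -- chosen functions are total.
  let Q : ∀ M : FinOrdStructure.{u, v, w} L lt, (γ → M) → (ι → M) → Prop := fun M x y =>
    P M x y ∨ ¬ ∃ z, P M x z
  have hQ : UnifDef fun M (x : γ ⊕ ι → M) => Q M (x ∘ Sum.inl) (x ∘ Sum.inr) :=
    hP.or ((UnifDef.exists_tuple hP).comap Sum.inl).not
  let S : ∀ M : FinOrdStructure.{u, v, w} L lt, (γ → M) → (ι → M) → Prop := fun M x y =>
    Q M x y ∧ ∀ z, Q M x z → y = z ∨ ∃ i : ι, (∀ j, e j < e i → y j = z j) ∧ y i < z i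
  have hS : UnifDef fun M (x : γ ⊕ ι → M) => S M (x ∘ Sum.inl) (x ∘ Sum.inr) := by
    refine hQ.and (UnifDef.forall_tuple (ι := ι) (P := fun M (x : γ ⊕ ι → M) z =>
      Q M (x ∘ Sum.inl) z → (x ∘ Sum.inr) = z ∨
        ∃ i : ι, (∀ j, e j < e i → (x ∘ Sum.inr) j = z j) ∧ (x ∘ Sum.inr) i < z i) ?_)
    refine UnifDef.imp (hQ.comap (Sum.map Sum.inl id)) (UnifDef.or ?_ ?_)
    · exact (UnifDef.finite_forall fun i : ι =>
        UnifDef.eq_var (γ := (γ ⊕ ι) ⊕ ι) (.inl (.inr i)) (.inr i)).congr fun M x => by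
          simp [funext_iff]
    · exact UnifDef.finite_exists fun i : ι => UnifDef.and
        (UnifDef.finite_forall fun j => UnifDef.imp (UnifDef.const _)
          (UnifDef.eq_var (γ := (γ ⊕ ι) ⊕ ι) (.inl (.inr j)) (.inr j)))
        (UnifDef.lt_var (γ := (γ ⊕ ι) ⊕ ι) (.inl (.inr i)) (.inr i))
  have hex : ∀ M x, ∃ y, S M x y := by
    intro M x
    obtain ⟨y₀, hy₀⟩ : ∃ y, Q M x y := by
      by_cases h : ∃ z, P M x z
      · exact h.imp fun _ => Or.inl
      · exact ⟨fun _ => Classical.arbitrary M, Or.inr h⟩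
    let f : (ι → M) → Lex (Fin N → M) := fun y => toLex (y ∘ e.symm)
    obtain ⟨y, hy, hmin⟩ := Set.exists_min_image {y | Q M x y} f (Set.toFinite _) ⟨y₀, hy₀⟩
    refine ⟨y, hy, fun z hz => ?_⟩
    rcases (hmin z hz).eq_or_lt with h | ⟨i, hi, hlt⟩
    · left
      have h' : y ∘ e.symm = z ∘ e.symm := toLex.injective h
      exact e.symm.surjective.injective_comp_right h'
    · refine Or.inr ⟨e.symm i, fun j hj => ?_, hlt⟩
      simpa [f] using hi (e j) (by simpa using hj)
  have huniq : ∀ M x y z, S M x y → S M x z → y = z := by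
    rintro M x y z ⟨hy, hy'⟩ ⟨hz, hz'⟩
    rcases hy' z hz with h | ⟨i, hi, hlt⟩
    · exact h
    rcases hz' y hy with h | ⟨j, hj, hlt'⟩
    · exact h.symm
    rcases lt_trichotomy (e i) (e j) with h | h | h
    · exact absurd (hj i h) hlt.ne'
    · rw [e.injective h] at hlt
      exact absurd hlt hlt'.not_gt
    · exact absurd (hi j h) hlt'.ne'
  choose F hF using hex
  refine ⟨fun i M x => F M x i, fun i => ?_, fun M x hx => ?_⟩
  · refine (UnifDef.exists_tuple (ι := ι) (P := fun M (x : γ ⊕ Unit → M) y =>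
      S M (x ∘ Sum.inl) y ∧ x (.inr ()) = y i)
      ((hS.comap (Sum.map Sum.inl id)).and (UnifDef.eq_var _ _))).congr fun M x => ?_
    constructor
    · rintro ⟨y, hy, h⟩
      rw [h, huniq _ _ _ _ hy (hF M _)]
    · exact fun h => ⟨_, hF M _, h⟩
  · exact (hF M x).1.resolve_right (not_not.2 hx)

end UniformDefinability

/-! ### Partitions of a finite linear order into points and intervals -/

section LabelPartition

open Set

variable {M : Type*} [LinearOrder M] [Finite M]

theorem exists_ncard_Ioc_eq (A B : M) (hAB : A < B) (j : ℕ) (hj : j ≤ (Ioo A B).ncard) :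
    ∃ A', A ≤ A' ∧ A' < B ∧ (Ioc A A').ncard = j := by
  induction j with
  | zero => exact ⟨A, le_rfl, hAB, by simp⟩
  | succ j ih =>
    obtain ⟨A', hA, hB, hc⟩ := ih (by omega)
    have hne : (Ioo A' B).Nonempty := by
      by_contra h
      rw [not_nonempty_iff_eq_empty] at h
      have : Ioo A B ⊆ Ioc A A' := fun y hy => by
        refine ⟨hy.1, not_lt.1 fun hy' => ?_⟩
        have : y ∈ Ioo A' B := ⟨hy', hy.2⟩
        simp [h] at this
      have := ncard_le_ncard this (toFinite _)
      omega
    obtain ⟨A'', hA'', hmin⟩ := exists_min_image (Ioo A' B) id (toFinite _) hne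
    refine ⟨A'', hA.trans hA''.1.le, hA''.2, ?_⟩
    have : Ioc A A'' = insert A'' (Ioc A A') := by
      ext y
      simp only [mem_Ioc, mem_insert_iff]
      constructor
      · rintro ⟨h1, h2⟩
        rcases h2.eq_or_lt with h | h
        · exact Or.inl h
        · refine Or.inr ⟨h1, not_lt.1 fun h' => ?_⟩
          exact absurd (hmin y ⟨h', h.trans hA''.2⟩) (not_le.2 h)
      · rintro (rfl | ⟨h1, h2⟩)
        · exact ⟨hA.trans_lt hA''.1, le_rfl⟩
        · exact ⟨h1, h2.trans hA''.1.le⟩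
    rw [this, ncard_insert_of_notMem (by simp [hA''.1]) (toFinite _), hc]

/-- An initial segment of prescribed size can be cut off from an open interval. -/
theorem exists_Ioo_split (A B : M) (j : ℕ) (hj : j < (Ioo A B).ncard) :
    ∃ A' C, A < C ∧ A' < B ∧ (Ioo A C).ncard = j ∧ Ioo A' B = Ioo A B \ Ioo A C ∧
      Ioo A C ⊆ Ioo A B := by
  have hAB : A < B := by
    by_contra h
    simp [Ioo_eq_empty h] at hj
  obtain ⟨A', hA, hB, hc⟩ := exists_ncard_Ioc_eq A B hAB j hj.le
  have hne : (Ioo A' B).Nonempty := by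
    by_contra h
    rw [not_nonempty_iff_eq_empty] at h
    have : Ioo A B ⊆ Ioc A A' := fun y hy => by
      refine ⟨hy.1, not_lt.1 fun hy' => ?_⟩
      have : y ∈ Ioo A' B := ⟨hy', hy.2⟩
      simp [h] at this
    have := ncard_le_ncard this (toFinite _)
    omega
  obtain ⟨C, hC, hmin⟩ := exists_min_image (Ioo A' B) id (toFinite _) hne
  have heq : Ioo A C = Ioc A A' := by
    ext y
    refine ⟨fun h => ⟨h.1, not_lt.1 fun h' => ?_⟩, fun h => ⟨h.1, h.2.trans_lt hC.1⟩⟩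
    exact absurd (hmin y ⟨h', h.2.trans hC.2⟩) (not_le.2 h.2)
  refine ⟨A', C, hA.trans_lt hC.1, hB, by rw [heq, hc], ?_, Ioo_subset_Ioo_right hC.2.le⟩
  rw [heq]
  ext y
  simp only [mem_Ioo, mem_sdiff, mem_Ioc, not_and, not_le]
  exact ⟨fun h => ⟨⟨hA.trans_lt h.1, h.2⟩, fun _ => h.1⟩, fun h => ⟨h.2 h.1.1, h.1.2⟩⟩

/-- Labels which are not used by a labelling can be given to prescribed numbers of points taken
from an interval which is the fibre of a label. -/
theorem exists_labelling_fill {Λ : Type*} (sz : Λ → ℕ) (hsz : ∀ i, sz i ≤ 2) (E : Finset Λ) :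
    ∀ (κ : M → Λ) (i₀ : Λ) (A B : M), i₀ ∉ E → κ ⁻¹' {i₀} = Ioo A B →
      (∀ i ∈ E, κ ⁻¹' {i} = ∅) → 2 * E.card + 2 ≤ (Ioo A B).ncard →
      ∃ (κ' : M → Λ) (A' : M), (∀ i ∉ E, i ≠ i₀ → κ' ⁻¹' {i} = κ ⁻¹' {i}) ∧
        κ' ⁻¹' {i₀} = Ioo A' B ∧ Ioo A' B ⊆ Ioo A B ∧ A' < B ∧ 2 ≤ (Ioo A' B).ncard ∧
        ∀ i ∈ E, ∃ p q, p < q ∧ κ' ⁻¹' {i} = Ioo p q ∧ (Ioo p q).ncard = sz i := by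
  classical
  induction E using Finset.induction_on with
  | empty =>
    intro κ i₀ A B _ h0 _ hc
    refine ⟨κ, A, fun _ _ _ => rfl, h0, subset_rfl, ?_, by simpa using hc, by simp⟩
    by_contra h
    simp [Ioo_eq_empty h] at hc
  | insert j E hj ih =>
    intro κ i₀ A B hi₀ h0 hE hc
    rw [Finset.card_insert_of_notMem hj] at hc
    have hne : i₀ ≠ j := fun h => hi₀ (h ▸ Finset.mem_insert_self _ _)
    -- At most two elements are spent on each label, so the interval keeps the two elements that the
    -- conclusion promises.
    obtain ⟨A₁, C, hAC, hA₁B, hcC, hA₁, hsub⟩ :=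
      exists_Ioo_split A B (sz j) (by have := hsz j; omega)
    let κ₁ : M → Λ := fun y => if y ∈ Ioo A C then j else κ y
    have hin : ∀ y, y ∈ Ioo A C → κ₁ y = j := fun y hy => if_pos hy
    have hout : ∀ y, y ∉ Ioo A C → κ₁ y = κ y := fun y hy => if_neg hy
    have hκ₁ : ∀ i, i ≠ j → i ≠ i₀ → κ₁ ⁻¹' {i} = κ ⁻¹' {i} := by
      intro i hij hi0
      ext y
      by_cases hy : y ∈ Ioo A C
      · have : κ y = i₀ := by
          have : y ∈ κ ⁻¹' {i₀} := h0 ▸ hsub hy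
          exact this
        simp [hin y hy, this, hij.symm, hi0.symm]
      · simp only [hout y hy, mem_preimage]
    have hκj : κ₁ ⁻¹' {j} = Ioo A C := by
      ext y
      by_cases hy : y ∈ Ioo A C
      · simp only [mem_preimage, hin y hy, hy, mem_singleton_iff]
      · have : y ∉ κ ⁻¹' {j} := by simp [hE j (Finset.mem_insert_self _ _)]
        have : κ y ≠ j := this
        simp only [mem_preimage, hout y hy, hy, mem_singleton_iff, this]
    have hκ0 : κ₁ ⁻¹' {i₀} = Ioo A₁ B := by
      rw [hA₁, ← h0]
      ext y
      by_cases hy : y ∈ Ioo A C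
      · simp only [mem_preimage, hin y hy, hy, mem_singleton_iff, hne.symm, mem_sdiff, not_true_eq_false, and_false]
      · simp only [hout y hy, hy, mem_preimage, mem_sdiff, not_false_eq_true, and_true]
    have hcA : 2 * E.card + 2 ≤ (Ioo A₁ B).ncard := by
      rw [hA₁, ncard_sdiff hsub (toFinite _), hcC]
      have := hsz j
      omega
    obtain ⟨κ', A', h1, h2, h3, h4, h5, h6⟩ := ih κ₁ i₀ A₁ B
      (fun h => hi₀ (Finset.mem_insert_of_mem h)) hκ0
      (fun i hi => by
        rw [hκ₁ i (fun h => hj (h ▸ hi)) (fun h => hi₀ (h ▸ Finset.mem_insert_of_mem hi))]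
        exact hE i (Finset.mem_insert_of_mem hi)) hcA
    refine ⟨κ', A', fun i hi hi0 => ?_, h2, h3.trans (hA₁ ▸ sdiff_subset), h4, h5, ?_⟩
    · rw [Finset.mem_insert, not_or] at hi
      rw [h1 i hi.2 hi0, hκ₁ i hi.1 hi0]
    · intro i hi
      rcases Finset.mem_insert.1 hi with rfl | hi
      · exact ⟨A, C, hAC, (h1 i hj hne.symm).trans hκj, hcC⟩
      · exact h6 i hi

/-- Points can be added to a finite set in such a way that no gap has exactly one element. -/
theorem exists_superset_no_isolated_gap (Q : Finset M) :
    ∃ Q' : Finset M, Q ⊆ Q' ∧ Q'.card ≤ 2 * Q.card ∧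
      ∀ p ∈ Q', ∀ q ∈ Q', ∀ y, Ioo p q = {y} → y ∈ Q' := by
  classical
  have := Fintype.ofFinite M
  let R : Finset M := {y | ∃ p ∈ Q, ∃ q ∈ Q, Ioo p q = {y}}
  have hR : ∀ y ∈ R, ∃ p ∈ Q, ∃ q ∈ Q, Ioo p q = {y} := fun y hy => by simpa [R] using hy
  have hmem : ∀ {p q y : M}, Ioo p q = {y} → p < y ∧ y < q := fun {p q y} h => by
    have : y ∈ Ioo p q := by simp [h]
    exact this
  have huniq : ∀ {p q y z : M}, Ioo p q = {y} → p < z → z < q → z = y := fun {p q y z} h h1 h2 => by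
    have : z ∈ Ioo p q := ⟨h1, h2⟩
    simpa [h] using this
  -- Sending an isolated element to the left end of its gap is injective.
  have hcard : R.card ≤ Q.card := by
    choose! f hfQ g hgQ hfg using hR
    refine Finset.card_le_card_of_injOn f hfQ fun y hy z hz hyz => ?_
    obtain ⟨h1, h2⟩ := hmem (hfg y hy)
    obtain ⟨h3, h4⟩ := hmem (hfg z hz)
    rcases lt_trichotomy y z with h | h | h
    · exact huniq (hfg z hz) (hyz ▸ h1) (h.trans h4)
    · exact h
    · exact (huniq (hfg y hy) (hyz ▸ h3) (h.trans h2)).symm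
  refine ⟨Q ∪ R, Finset.subset_union_left, (Finset.card_union_le _ _).trans (by omega), ?_⟩
  intro p hp q hq y hy
  obtain ⟨hpy, hyq⟩ := hmem hy
  by_contra hyn
  rw [Finset.mem_union, not_or] at hyn
  -- The neighbours of an isolated element lie in `Q`. If `p` were isolated, its right neighbour
  -- would have to be `y`, which is not in `Q`. So the added elements create no new one-element
  -- gaps, and one round of additions is enough.
  have hp' : p ∈ Q := by
    refine (Finset.mem_union.1 hp).resolve_right fun hpR => ?_
    obtain ⟨a, ha, b, hb, hab⟩ := hR p hpR
    have hb1 := hmem hab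
    have hby : b ≤ y := not_lt.1 fun h => hpy.ne' (huniq hab (hb1.1.trans hpy) h)
    have := huniq hy hb1.2 (hby.trans_lt hyq)
    exact hyn.1 (this ▸ hb)
  have hq' : q ∈ Q := by
    refine (Finset.mem_union.1 hq).resolve_right fun hqR => ?_
    obtain ⟨a, ha, b, hb, hab⟩ := hR q hqR
    have hb1 := hmem hab
    have hby : y ≤ a := not_lt.1 fun h => hyq.ne (huniq hab h (hyq.trans hb1.2))
    have := huniq hy (hpy.trans_le hby) hb1.1
    exact hyn.1 (this ▸ ha)
  exact hyn.2 (by simpa [R] using ⟨p, hp', q, hq', hy⟩)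

/-- The labelling of a finite linear order by the points of a finite set `Q` and the gaps
of `Q`. -/
theorem exists_gap_labelling {V : Type*} (Good : V → M → M → Prop) (Q : Finset M) {N : ℕ}
    (hN : Q.card ≤ N)
    (hgap : ∀ p q, (Ioo p q).Nonempty → (∀ y ∈ Ioo p q, y ∉ Q) → ∃ i, Good i p q)
    (hbelow : ∀ y ∉ Q, ∃ q ∈ Q, q < y) (habove : ∀ y ∉ Q, ∃ q ∈ Q, y < q)
    (hiso : ∀ p ∈ Q, ∀ q ∈ Q, ∀ y, Ioo p q = {y} → y ∈ Q) :
    ∃ κ : M → Fin N ⊕ (Fin N × V), (∀ l, (κ ⁻¹' {.inl l}).Subsingleton) ∧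
      ∀ t, κ ⁻¹' {.inr t} = ∅ ∨
        ∃ p q, p < q ∧ κ ⁻¹' {.inr t} = Ioo p q ∧ 2 ≤ (Ioo p q).ncard ∧ Good t.2 p q := by
  classical
  have hadj : ∀ y, y ∉ Q → ∃ p ∈ Q, ∃ q ∈ Q, y ∈ Ioo p q ∧ ∀ z ∈ Ioo p q, z ∉ Q := by
    intro y hy
    obtain ⟨p, hp, hpmax⟩ := exists_max_image {q | q ∈ Q ∧ q < y} id (toFinite _)
      ((hbelow y hy).imp fun _ h => h)
    obtain ⟨q, hq, hqmin⟩ := exists_min_image {q | q ∈ Q ∧ y < q} id (toFinite _)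
      ((habove y hy).imp fun _ h => h)
    refine ⟨p, hp.1, q, hq.1, ⟨hp.2, hq.2⟩, fun z hz hzQ => ?_⟩
    rcases lt_trichotomy z y with h | h | h
    · exact absurd (hpmax z ⟨hzQ, h⟩) (not_le.2 hz.1)
    · exact hy (h ▸ hzQ)
    · exact absurd (hqmin z ⟨hzQ, h⟩) (not_le.2 hz.2)
  choose! p hp q hq hy hpq using hadj
  have hsame : ∀ y ∉ Q, ∀ z ∉ Q, z ∈ Ioo (p y) (q y) → p z = p y := by
    intro y hyQ z hzQ hz
    rcases lt_trichotomy (p z) (p y) with h | h | h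
    · exact absurd (hp y hyQ) (hpq z hzQ _ ⟨h, hz.1.trans (hy z hzQ).2⟩)
    · exact h
    · exact absurd (hp z hzQ) (hpq y hyQ _ ⟨h, (hy z hzQ).1.trans hz.2⟩)
  have hsame' : ∀ y ∉ Q, ∀ z ∉ Q, p z = p y → q z = q y := by
    intro y hyQ z hzQ hz
    rcases lt_trichotomy (q z) (q y) with h | h | h
    · exact absurd (hq z hzQ)
        (hpq y hyQ _ ⟨hz ▸ (hy z hzQ).1.trans (hy z hzQ).2, h⟩)
    · exact h
    · exact absurd (hq y hyQ)
        (hpq z hzQ _ ⟨hz ▸ (hy y hyQ).1.trans (hy y hyQ).2, h⟩)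
  let e : Q → Fin N := fun x => Fin.castLE hN (Q.equivFin x)
  have he : Function.Injective e := (Fin.castLE_injective hN).comp Q.equivFin.injective
  -- The colour is chosen from the end points of the gap alone, hence is constant along the gap.
  let c : ∀ y, y ∉ Q → V := fun y hyQ =>
    (hgap (p y) (q y) ⟨y, hy y hyQ⟩ (hpq y hyQ)).choose
  have hc : ∀ y hyQ, Good (c y hyQ) (p y) (q y) := fun y hyQ =>
    (hgap (p y) (q y) ⟨y, hy y hyQ⟩ (hpq y hyQ)).choose_spec
  have hcc : ∀ y hyQ z hzQ, p z = p y → c z hzQ = c y hyQ := by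
    intro y hyQ z hzQ hz
    have h' := hsame' y hyQ z hzQ hz
    simp only [c]
    congr 1
    simp only [hz, h']
  -- Recording the left end point separates different gaps of the same colour.
  let κ : M → Fin N ⊕ (Fin N × V) := fun y =>
    if h : y ∈ Q then .inl (e ⟨y, h⟩) else .inr (e ⟨p y, hp y h⟩, c y h)
  have hκ1 : ∀ y (h : y ∈ Q), κ y = .inl (e ⟨y, h⟩) := fun y h => dif_pos h
  have hκ2 : ∀ y (h : y ∉ Q), κ y = .inr (e ⟨p y, hp y h⟩, c y h) := fun y h => dif_neg h
  refine ⟨κ, fun l y hyl z hzl => ?_, fun t => ?_⟩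
  · replace hyl : κ y = .inl l := hyl
    replace hzl : κ z = .inl l := hzl
    by_cases h1 : y ∈ Q
    · by_cases h2 : z ∈ Q
      · rw [hκ1 y h1] at hyl
        rw [hκ1 z h2] at hzl
        have := he (Sum.inl_injective (hyl.trans hzl.symm))
        simpa using this
      · rw [hκ2 z h2] at hzl
        cases hzl
    · rw [hκ2 y h1] at hyl
      cases hyl
  · rcases (κ ⁻¹' {.inr t}).eq_empty_or_nonempty with h | ⟨y, hyt⟩
    · exact Or.inl h
    right
    replace hyt : κ y = .inr t := hyt
    have hyQ : y ∉ Q := fun h => by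
      rw [hκ1 y h] at hyt
      cases hyt
    rw [hκ2 y hyQ] at hyt
    obtain rfl := Sum.inr_injective hyt
    refine ⟨p y, q y, (hy y hyQ).1.trans (hy y hyQ).2, ?_, ?_, hc y hyQ⟩
    · ext z
      simp only [mem_preimage, mem_singleton_iff]
      constructor
      · intro hz
        have hzQ : z ∉ Q := fun h => by
          rw [hκ1 z h] at hz
          cases hz
        rw [hκ2 z hzQ] at hz
        have h1 := he (Prod.ext_iff.1 (Sum.inr_injective hz)).1
        have h1' : p z = p y := by simpa using h1
        rw [← h1', ← hsame' y hyQ z hzQ h1']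
        exact hy z hzQ
      · intro hz
        have hzQ := hpq y hyQ z hz
        have h1 := hsame y hyQ z hzQ hz
        rw [hκ2 z hzQ, hcc y hyQ z hzQ h1]
        simp only [h1]
    · by_contra hlt
      have hpos : 0 < (Ioo (p y) (q y)).ncard := (ncard_pos (toFinite _)).2 ⟨y, hy y hyQ⟩
      obtain ⟨a, ha⟩ := ncard_eq_one.1 (show (Ioo (p y) (q y)).ncard = 1 by omega)
      have hya : y = a := by simpa [ha] using hy y hyQ
      exact hyQ (hiso _ (hp y hyQ) _ (hq y hyQ) y (hya ▸ ha))

/-- A large finite linear order whose gaps outside a small set `Q` are coloured is partitioned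
into a fixed number of points and a fixed number of intervals of each colour; apart from those of
a null colour the intervals have at least two elements. -/
theorem exists_interval_labelling {V : Type*} [Finite V] (null : V → Prop) (s : ℕ) :
    ∃ K : ℕ, ∀ (M : Type w) [LinearOrder M] [Finite M] (Good : V → M → M → Prop) (Q : Finset M),
      K < Nat.card M → Q.card ≤ s →
      (∀ i p q p' q', Good i p q → Ioo p' q' ⊆ Ioo p q → Good i p' q') →
      (∀ p q, (Ioo p q).Nonempty → (∀ y ∈ Ioo p q, y ∉ Q) → ∃ i, Good i p q) →
      (∀ y ∉ Q, ∃ q ∈ Q, q < y) → (∀ y ∉ Q, ∃ q ∈ Q, y < q) →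
      ∃ κ : M → Fin (2 * s) ⊕ (Fin (2 * s) × V), (∀ l, ∃ y, κ ⁻¹' {.inl l} = {y}) ∧
        ∀ t, ∃ p q, p < q ∧ κ ⁻¹' {.inr t} = Ioo p q ∧
          (null t.2 → Ioo p q = ∅ ∨ Good t.2 p q) ∧
          (¬ null t.2 → 2 ≤ (Ioo p q).ncard ∧ ((Ioo p q).ncard ≤ 2 ∨ Good t.2 p q)) := by
  classical
  have := Fintype.ofFinite V
  let Λ := Fin (2 * s) ⊕ (Fin (2 * s) × V)
  -- Pigeonhole: above this size some label has more than `2 * card Λ + 2` elements. That is room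
  -- for two elements per unused label, with two left over.
  refine ⟨Fintype.card Λ * (2 * Fintype.card Λ + 2), ?_⟩
  intro M _ _ Good Q hK hQs hered hgap hbelow habove
  have := Fintype.ofFinite M
  rw [Nat.card_eq_fintype_card] at hK
  obtain ⟨Q', hQQ', hcard, hiso⟩ := exists_superset_no_isolated_gap Q
  obtain ⟨κ, hκ1, hκ2⟩ := exists_gap_labelling Good Q' (N := 2 * s) (by omega)
    (fun p q hne h => hgap p q hne fun y hy hyQ => h y hy (hQQ' hyQ))
    (fun y hy => (hbelow y fun h => hy (hQQ' h)).imp fun _ h => ⟨hQQ' h.1, h.2⟩)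
    (fun y hy => (habove y fun h => hy (hQQ' h)).imp fun _ h => ⟨hQQ' h.1, h.2⟩) hiso
  obtain ⟨i₀, hi₀⟩ := Fintype.exists_lt_card_fiber_of_mul_lt_card κ hK
  have hi₀' : 2 * Fintype.card Λ + 2 < (κ ⁻¹' {i₀}).ncard := by
    rw [← ncard_coe_finset] at hi₀
    simpa [preimage] using hi₀
  obtain ⟨t₀, rfl⟩ : ∃ t₀, i₀ = .inr t₀ := by
    rcases i₀ with l | t
    · have := ncard_le_one_iff_subsingleton.2 (hκ1 l)
      omega
    · exact ⟨t, rfl⟩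
  obtain ⟨A, B, hAB, hpre, -, hgood⟩ := (hκ2 t₀).resolve_left fun h => by simp [h] at hi₀'
  rw [hpre] at hi₀'
  -- Only points and non-null intervals have to be nonempty; an unused null label can be given an
  -- empty interval.
  let needed : Λ → Prop := Sum.elim (fun _ => True) fun t => ¬ null t.2
  let E : Finset Λ := {i | κ ⁻¹' {i} = ∅ ∧ needed i}
  have hE : ∀ i, i ∈ E ↔ κ ⁻¹' {i} = ∅ ∧ needed i := by simp [E]
  have h0E : (.inr t₀ : Λ) ∉ E := fun h => by
    have := ((hE _).1 h).1
    rw [hpre] at this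
    simp [this] at hi₀'
  have hEc : E.card ≤ Fintype.card Λ := Finset.card_le_univ E
  obtain ⟨κ', A', h1, h2, h3, h4, h5, h6⟩ := exists_labelling_fill
    (Sum.elim (fun _ => 1) fun _ => 2) (by rintro (_ | _) <;> simp) E κ (.inr t₀) A B h0E hpre
    (fun i hi => ((hE i).1 hi).1) (by omega)
  refine ⟨κ', fun l => ?_, fun t => ?_⟩
  · by_cases hl : (.inl l : Λ) ∈ E
    · obtain ⟨p, q, -, h, hc⟩ := h6 _ hl
      rw [h]
      exact ncard_eq_one.1 hc
    · rw [h1 _ hl (by simp)]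
      have hne : (κ ⁻¹' {.inl l}).Nonempty := by
        rw [hE] at hl
        rw [nonempty_iff_ne_empty]
        exact fun h => hl ⟨h, trivial⟩
      exact exists_eq_singleton_iff_nonempty_subsingleton.2 ⟨hne, hκ1 l⟩
  · by_cases ht : (.inr t : Λ) ∈ E
    · obtain ⟨p, q, hpq, h, hc⟩ := h6 _ ht
      refine ⟨p, q, hpq, h, fun hn => absurd hn ((hE _).1 ht).2, fun _ => ?_⟩
      simp only [Sum.elim_inr] at hc
      exact ⟨hc.ge, Or.inl hc.le⟩
    by_cases ht0 : t = t₀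
    · subst ht0
      have hg := hered _ _ _ _ _ hgood h3
      exact ⟨A', B, h4, h2, fun _ => Or.inr hg, fun _ => ⟨h5, Or.inr hg⟩⟩
    · rw [h1 _ ht fun h => ht0 (Sum.inr_injective h)]
      rcases hκ2 t with h | ⟨p, q, hpq, h, hc, hg⟩
      · have hnull : null t.2 := by
          by_contra hn
          exact ht ((hE _).2 ⟨h, hn⟩)
        -- Cutting off no elements yields the successor `q` of `A`: the interval is empty although
        -- `A < q`, the strict inequality that bands require.
        obtain ⟨-, q, hq, -, hcq, -, -⟩ := exists_Ioo_split A B 0 (by omega)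
        have hcq' : Ioo A q = ∅ := (ncard_eq_zero (toFinite _)).1 hcq
        exact ⟨A, q, hq, h.trans hcq'.symm,
          fun _ => Or.inl hcq', fun hn => absurd hnull hn⟩
      · exact ⟨p, q, hpq, h, fun _ => Or.inr hg, fun _ => ⟨hc, Or.inr hg⟩⟩

end LabelPartition

/-! ### Uniform partition of the fibres of a definable family -/

section FibrePartition

variable {L : FirstOrder.Language.{u, v}} {lt : L.Relations 2} {γ δ : Type}

theorem exists_fin_range_superset {M : Type*} [Nonempty M] {s : Set M} (hs : s.Finite) {r : ℕ}
    (hr : s.ncard ≤ r) : ∃ f : Fin r → M, ∀ y ∈ s, ∃ i, y = f i := by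
  classical
  have : Fintype s := hs.fintype
  have e : s ≃ Fin s.ncard := (Finite.equivFinOfCardEq rfl)
  refine ⟨fun i => if h : (i : ℕ) < s.ncard then e.symm ⟨i, h⟩ else Classical.arbitrary M,
    fun y hy => ⟨Fin.castLE hr (e ⟨y, hy⟩), ?_⟩⟩
  have h : ((Fin.castLE hr (e ⟨y, hy⟩) : Fin r) : ℕ) < s.ncard := (e ⟨y, hy⟩).2
  simp only [dif_pos h]
  simp

theorem ncard_le_of_forall_exists_eq {M : Type*} {s : Set M} {r : ℕ} (f : Fin r → M)
    (hf : ∀ y ∈ s, ∃ i, y = f i) : s.ncard ≤ r := by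
  have h : s ⊆ f '' Set.univ := fun y hy => by
    obtain ⟨i, rfl⟩ := hf y hy
    exact ⟨i, trivial, rfl⟩
  calc s.ncard ≤ (f '' Set.univ).ncard := Set.ncard_le_ncard h (Set.toFinite _)
    _ ≤ (Set.univ : Set (Fin r)).ncard := Set.ncard_image_le
    _ = r := by simp

/-- A bound `r` on the size is first-order: some `r`-tuple, possibly with repetitions, lists all
elements. -/
theorem UnifDef.ncard_le {P : ∀ M : FinOrdStructure.{u, v, w} L lt, (γ → M) → M → Prop}
    (hP : UnifDef fun M (x : γ ⊕ Unit → M) => P M (x ∘ Sum.inl) (x (Sum.inr ()))) (r : ℕ) :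
    UnifDef fun M x => {y | P M x y}.ncard ≤ r := by
  have h : UnifDef fun M x => ∃ f : Fin r → M, ∀ y, P M x y → ∃ i, y = f i := by
    refine UnifDef.exists_tuple (ι := Fin r) (P := fun M x f => ∀ y, P M x y → ∃ i, y = f i) ?_
    refine UnifDef.forall_elem (P := fun M (x : γ ⊕ Fin r → M) y =>
      P M (x ∘ Sum.inl) y → ∃ i, y = (x ∘ Sum.inr) i) ?_
    exact (hP.comap (Sum.map Sum.inl id)).imp (UnifDef.finite_exists fun i =>
      UnifDef.eq_var (γ := (γ ⊕ Fin r) ⊕ Unit) (Sum.inr ()) (Sum.inl (Sum.inr i)))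
  exact h.congr fun M x => ⟨fun ⟨f, hf⟩ => ncard_le_of_forall_exists_eq f hf,
    fun h => exists_fin_range_superset (Set.toFinite _) h⟩

theorem UnifDef.isSubdivision {k : ℕ} {c : Fin (k + 1) → γ} :
    UnifDef fun (_M : FinOrdStructure.{u, v, w} L lt) x => IsSubdivision fun i => x (c i) := by
  have h : UnifDef fun (M : FinOrdStructure.{u, v, w} L lt) x =>
      (∀ i j, i ≤ j → x (c i) ≤ x (c j)) ∧ (∀ y, x (c 0) ≤ y) ∧ ∀ y, y ≤ x (c (Fin.last k)) := by
    refine (finite_forall fun i => finite_forall fun j => (const _).imp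
      ((UnifDefFun.var _).rel_le (UnifDefFun.var _))).and ((forall_elem ?_).and (forall_elem ?_))
    · exact (UnifDefFun.var (γ := γ ⊕ Unit) (Sum.inl (c 0))).rel_le (UnifDefFun.var (Sum.inr ()))
    · exact (UnifDefFun.var (γ := γ ⊕ Unit) (Sum.inr ())).rel_le (UnifDefFun.var (Sum.inl (c _)))
  refine h.congr fun M x => ?_
  simp [IsSubdivision, Monotone, IsLeast, IsGreatest, lowerBounds, upperBounds]

/-- The points of a subdivision together with the elements of the parts of measure zero. -/
theorem exists_cut_set {M : Type*} [LinearOrder M] [Finite M] {S : Set M} {C : ℝ} {k : ℕ}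
    {μ : Fin k → ℝ} {c : Fin (k + 1) → M} (hc : IsSubdivision c)
    (hμ : UniformlyDistributed S C μ c) :
    ∃ Q : Finset M, Q.card ≤ k + 1 + k * ⌊C⌋₊ ∧ (∀ y ∉ Q, ∃ q ∈ Q, q < y) ∧
      (∀ y ∉ Q, ∃ q ∈ Q, y < q) ∧
      ∀ p q, (Set.Ioo p q).Nonempty → (∀ y ∈ Set.Ioo p q, y ∉ Q) →
        ∃ i : Fin k, (μ i = 0 → ∀ y ∈ Set.Ioo p q, y ∉ S) ∧
          Set.Ioo p q ⊆ Set.Ioo (c i.castSucc) (c i.succ) := by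
  classical
  have := Fintype.ofFinite M
  let R : Fin k → Finset M := fun i =>
    if μ i = 0 then (S ∩ Set.Ioo (c i.castSucc) (c i.succ)).toFinite.toFinset else ∅
  have hR : ∀ i, (R i).card ≤ ⌊C⌋₊ := by
    intro i
    by_cases hi : μ i = 0
    · simp only [R, if_pos hi]
      rw [← Set.ncard_eq_toFinset_card]
      rcases hμ i with h | h
      · exact Nat.le_floor h.2
      · exact absurd hi h.1.ne'
    · simp [R, hi]
  let Q := Finset.univ.image c ∪ Finset.univ.biUnion R
  have hcQ : ∀ i, c i ∈ Q := fun i =>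
    Finset.mem_union_left _ (Finset.mem_image_of_mem _ (Finset.mem_univ _))
  have hlow : ∀ y ∉ Q, c 0 < y := fun y hy =>
    (hc.2.1.2 trivial).lt_of_ne fun h => hy (h ▸ hcQ 0)
  have hhigh : ∀ y ∉ Q, y < c (Fin.last k) := fun y hy =>
    (hc.2.2.2 trivial).lt_of_ne fun h => hy (h ▸ hcQ _)
  refine ⟨Q, ?_, fun y hy => ⟨c 0, hcQ 0, hlow y hy⟩, fun y hy => ⟨_, hcQ _, hhigh y hy⟩, ?_⟩
  · refine (Finset.card_union_le _ _).trans (add_le_add ?_ ?_)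
    · exact Finset.card_image_le.trans (by simp)
    · refine (Finset.card_biUnion_le).trans ((Finset.sum_le_sum fun i _ => hR i).trans ?_)
      simp
  · rintro p q ⟨y, hy⟩ hpq
    have hyQ := hpq y hy
    obtain ⟨i, hi1, hi2⟩ : ∃ i : Fin k, c i.castSucc < y ∧ y < c i.succ := by
      -- If no part contained `y`, induction along the subdivision would put every `c i` below `y`,
      -- including the maximum of `M`.
      by_contra! h
      have : ∀ i : Fin (k + 1), c i < y := by
        intro i
        induction i using Fin.induction with
        | zero => exact hlow y hyQ
        | succ i ih => exact (h i ih).lt_of_ne fun h' => hyQ (h' ▸ hcQ _)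
      exact (this _).not_gt (hhigh y hyQ)
    have hsub : Set.Ioo p q ⊆ Set.Ioo (c i.castSucc) (c i.succ) := by
      intro z hz
      constructor
      · by_contra! h
        exact hpq _ ⟨hz.1.trans_le h, hi1.trans hy.2⟩ (hcQ _)
      · by_contra! h
        exact hpq _ ⟨hy.1.trans hi2, h.trans_lt hz.2⟩ (hcQ _)
    refine ⟨i, fun hi z hz hzS => hpq z hz (Finset.mem_union_right _ ?_), hsub⟩
    refine Finset.mem_biUnion.2 ⟨i, Finset.mem_univ _, ?_⟩
    simpa [R, hi] using ⟨hzS, hsub hz⟩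

/-- In an `𝒪`-asymptotic class, the fibres of a uniformly definable family of subsets of `M` are
uniformly cut: up to finitely many sizes of `M`, uniformly definable functions partition `M` into a
fixed number of points and a fixed number of intervals, on each of which the fibre is empty or
has a prescribed positive density. -/
theorem exists_fibre_partition {𝒞 : Set (FinOrdStructure.{u, v, w} L lt)} {Δ : MeasureSystem L}
    (hΔ : Δ.Witnesses 𝒞) [Finite δ]
    {S : ∀ M : FinOrdStructure.{u, v, w} L lt, (δ → M) → M → Prop}
    (hS : UnifDef fun M (x : δ ⊕ Unit → M) => S M (x ∘ Sum.inl) (x (Sum.inr ()))) :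
    ∃ (H T : Type) (_ : Finite H) (_ : Finite T) (v : T → ℝ) (C : ℝ) (K : ℕ)
      (h : H → ∀ M : FinOrdStructure.{u, v, w} L lt, (δ → M) → M)
      (f g : T → ∀ M : FinOrdStructure.{u, v, w} L lt, (δ → M) → M),
      0 < C ∧ (∀ t, v t ∈ Set.Icc (0 : ℝ) 1) ∧ (∀ l, UnifDefFun (h l)) ∧
      (∀ t, UnifDefFun (f t)) ∧ (∀ t, UnifDefFun (g t)) ∧
      ∀ M ∈ 𝒞, K < Nat.card M → ∀ x,
        (∀ y, ∃! i : H ⊕ T, Sum.elim (fun l => y = h l M x)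
          (fun t => y ∈ Set.Ioo (f t M x) (g t M x)) i) ∧
        ∀ t, f t M x < g t M x ∧
          (v t = 0 → ∀ y ∈ Set.Ioo (f t M x) (g t M x), ¬ S M x y) ∧
          (v t ≠ 0 → 2 ≤ (Set.Ioo (f t M x) (g t M x)).ncard ∧
            |(({y | S M x y} ∩ Set.Ioo (f t M x) (g t M x)).ncard : ℝ)
              - v t * ((Set.Ioo (f t M x) (g t M x)).ncard : ℝ)|
              ≤ C * ((Set.Ioo (f t M x) (g t M x)).ncard : ℝ) ^ (1 / 2 : ℝ)) := by
  classical
  obtain ⟨φ₀, hφ₀⟩ := id hS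
  obtain ⟨m, ⟨e⟩⟩ := Finite.exists_equiv_fin δ
  let φ : L.Formula (Fin 1 ⊕ Fin m) := φ₀.relabel (Sum.elim (Sum.inr ∘ e) fun _ => Sum.inl 0)
  have hφ : ∀ (M : FinOrdStructure.{u, v, w} L lt) (x : δ → M),
      defSet₁ M φ (x ∘ e.symm) = {y | S M x y} := by
    intro M x
    ext y
    simp only [defSet₁, φ, FirstOrder.Language.Formula.realize_relabel, Set.mem_ofPred_eq]
    rw [hφ₀]
    simp [Function.comp_def]
  let D := Δ m φ
  let V := D.E × Fin D.k
  let val : V → ℝ := fun t => t.1.1 t.2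
  -- A first-order certificate that `(p, q)` has the density belonging to `t`: it lies in a part of
  -- a subdivision accepted by the `μ`-definition. Clause (2) turns any such subdivision into the
  -- estimate, so it does not matter which one is found.
  let Good : ∀ M : FinOrdStructure.{u, v, w} L lt, (δ → M) → V → M → M → Prop := fun M x t p q =>
    (val t = 0 → ∀ y, y ∈ Set.Ioo p q → ¬ S M x y) ∧ ∃ c : Fin (D.k + 1) → M, IsSubdivision c ∧
      (D.defn t.1).Realize (Sum.elim (x ∘ e.symm) fun i => c i.succ) ∧
      ∀ y, y ∈ Set.Ioo p q → y ∈ Set.Ioo (c t.2.castSucc) (c t.2.succ)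
  have hGood : ∀ t, UnifDef fun M (x : δ ⊕ Fin 2 → M) =>
      Good M (x ∘ Sum.inl) t (x (Sum.inr 0)) (x (Sum.inr 1)) := by
    intro t
    refine ((UnifDef.const _).imp (UnifDef.forall_elem (UnifDef.imp ?_ (UnifDef.not ?_)))).and
      (UnifDef.exists_tuple ((UnifDef.and ?_ ((UnifDef.and ?_ (UnifDef.forall_elem
        (UnifDef.imp ?_ ?_)))))))
    · exact (UnifDefFun.var (γ := (δ ⊕ Fin 2) ⊕ Unit) (Sum.inr ())).mem_Ioo
        (UnifDefFun.var (Sum.inl (Sum.inr 0))) (UnifDefFun.var (Sum.inl (Sum.inr 1)))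
    · exact hS.comap (γ := (δ ⊕ Fin 2) ⊕ Unit)
        (Sum.elim (fun d => Sum.inl (Sum.inl d)) fun _ => Sum.inr ())
    · exact UnifDef.isSubdivision (γ := (δ ⊕ Fin 2) ⊕ Fin (D.k + 1)) (c := Sum.inr)
    · refine ((UnifDef.realize (D.defn t.1)).comap (γ := (δ ⊕ Fin 2) ⊕ Fin (D.k + 1))
        (Sum.elim (fun i => Sum.inl (Sum.inl (e.symm i))) fun i => Sum.inr i.succ)).congr fun M x => ?_
      rw [iff_iff_eq]
      congr 1
      ext (i | i) <;> rfl
    · exact (UnifDefFun.var (γ := ((δ ⊕ Fin 2) ⊕ Fin (D.k + 1)) ⊕ Unit) (Sum.inr ())).mem_Ioo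
        (UnifDefFun.var (Sum.inl (Sum.inl (Sum.inr 0)))) (UnifDefFun.var (Sum.inl (Sum.inl (Sum.inr 1))))
    · exact (UnifDefFun.var (γ := ((δ ⊕ Fin 2) ⊕ Fin (D.k + 1)) ⊕ Unit) (Sum.inr ())).mem_Ioo
        (UnifDefFun.var (Sum.inl (Sum.inr _))) (UnifDefFun.var (Sum.inl (Sum.inr _)))
  obtain ⟨K, hK⟩ := exists_interval_labelling (fun t : V => val t = 0) (D.k + 1 + D.k * ⌊D.C⌋₊)
  generalize 2 * (D.k + 1 + D.k * ⌊D.C⌋₊) = N at hK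
  let T := Fin N × V
  let piece : ∀ M : FinOrdStructure.{u, v, w} L lt, (Fin N ⊕ (T ⊕ T) → M) → M → Fin N ⊕ T → Prop :=
    fun M z y => Sum.elim (fun l => y = z (Sum.inl l))
      fun t => y ∈ Set.Ioo (z (Sum.inr (Sum.inl t))) (z (Sum.inr (Sum.inr t)))
  -- The condition handed to definable choice. Two-element intervals need no certificate, which
  -- admits the pieces cut off to fill unused labels.
  let P : ∀ M : FinOrdStructure.{u, v, w} L lt, (δ → M) → (Fin N ⊕ (T ⊕ T) → M) → Prop :=
    fun M x z => (∀ y, ∃ i, piece M z y i ∧ ∀ j, piece M z y j → j = i) ∧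
      ∀ t : T, z (Sum.inr (Sum.inl t)) < z (Sum.inr (Sum.inr t)) ∧
        (val t.2 = 0 → (∀ y, ¬ y ∈ Set.Ioo (z (Sum.inr (Sum.inl t))) (z (Sum.inr (Sum.inr t)))) ∨
          Good M x t.2 (z (Sum.inr (Sum.inl t))) (z (Sum.inr (Sum.inr t)))) ∧
        (¬ val t.2 = 0 → ¬ (Set.Ioo (z (Sum.inr (Sum.inl t))) (z (Sum.inr (Sum.inr t)))).ncard ≤ 1 ∧
          ((Set.Ioo (z (Sum.inr (Sum.inl t))) (z (Sum.inr (Sum.inr t)))).ncard ≤ 2 ∨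
          Good M x t.2 (z (Sum.inr (Sum.inl t))) (z (Sum.inr (Sum.inr t)))))
  have hP : UnifDef fun M (x : δ ⊕ (Fin N ⊕ (T ⊕ T)) → M) => P M (x ∘ Sum.inl) (x ∘ Sum.inr) := by
    have hpiece : ∀ i, UnifDef fun M (x : (δ ⊕ (Fin N ⊕ (T ⊕ T))) ⊕ Unit → M) =>
        piece M (x ∘ Sum.inl ∘ Sum.inr) (x (Sum.inr ())) i := by
      rintro (l | t)
      · exact UnifDef.eq_var (γ := (δ ⊕ (Fin N ⊕ (T ⊕ T))) ⊕ Unit) (Sum.inr ()) (Sum.inl (Sum.inr (Sum.inl l)))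
      · exact (UnifDefFun.var (γ := (δ ⊕ (Fin N ⊕ (T ⊕ T))) ⊕ Unit) (Sum.inr ())).mem_Ioo
          (UnifDefFun.var (Sum.inl (Sum.inr (Sum.inr (Sum.inl t))))) (UnifDefFun.var (Sum.inl (Sum.inr (Sum.inr (Sum.inr t)))))
    have hIoo : ∀ t : T, UnifDef fun M (x : (δ ⊕ (Fin N ⊕ (T ⊕ T))) ⊕ Unit → M) =>
        x (Sum.inr ()) ∈ Set.Ioo (x (Sum.inl (Sum.inr (Sum.inr (Sum.inl t)))))
          (x (Sum.inl (Sum.inr (Sum.inr (Sum.inr t))))) := fun t => hpiece (Sum.inr t)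
    have hgood : ∀ t : T, UnifDef fun M (x : δ ⊕ (Fin N ⊕ (T ⊕ T)) → M) =>
        Good M (x ∘ Sum.inl) t.2 (x (Sum.inr (Sum.inr (Sum.inl t)))) (x (Sum.inr (Sum.inr (Sum.inr t)))) := fun t =>
      (hGood t.2).comap (γ := δ ⊕ (Fin N ⊕ (T ⊕ T)))
        (Sum.elim Sum.inl ![Sum.inr (Sum.inr (Sum.inl t)), Sum.inr (Sum.inr (Sum.inr t))])
    refine (UnifDef.forall_elem (UnifDef.finite_exists fun i => (hpiece i).and
      (UnifDef.finite_forall fun j => (hpiece j).imp (UnifDef.const _)))).and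
      (UnifDef.finite_forall fun t => UnifDef.and ?_ (UnifDef.and ?_ ?_))
    · exact UnifDef.lt_var (γ := δ ⊕ (Fin N ⊕ (T ⊕ T))) _ _
    · exact (UnifDef.const _).imp ((UnifDef.forall_elem (hIoo t).not).or (hgood t))
    · exact (UnifDef.const _).imp (((UnifDef.ncard_le (hIoo t) 1).not).and
        ((UnifDef.ncard_le (hIoo t) 2).or (hgood t)))
  obtain ⟨F, hF, hFP⟩ := UnifDef.exists_choice hP
  -- The summand `2` pays for intervals of two elements, where the count and the density times the
  -- length both lie between `0` and `2`.
  refine ⟨Fin N, T, inferInstance, inferInstance, fun t => val t.2, D.C + 2, K,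
    fun l => F (Sum.inl l), fun t => F (Sum.inr (Sum.inl t)), fun t => F (Sum.inr (Sum.inr t)),
    by linarith [D.C_pos], fun t => D.E_mem _ t.2.1.2 _, fun l => hF _, fun t => hF _,
    fun t => hF _, ?_⟩
  intro M hM hKM x
  obtain ⟨⟨c, μ, hμE, hc, hμ, hdef⟩, hall⟩ := hΔ m φ M hM (x ∘ e.symm)
  rw [hφ] at hμ
  obtain ⟨Q, hQ, hbelow, habove, hgap⟩ := exists_cut_set hc hμ
  obtain ⟨κ, hκ1, hκ2⟩ := hK M (Good M x) Q hKM hQ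
    (fun t p q p' q' h hsub => ⟨fun h0 y hy => h.1 h0 y (hsub hy), h.2.imp fun c hc =>
      ⟨hc.1, hc.2.1, fun y hy => hc.2.2 y (hsub hy)⟩⟩)
    (fun p q hne hpq => by
      obtain ⟨i, hi0, hi⟩ := hgap p q hne hpq
      exact ⟨(⟨μ, hμE⟩, i), hi0, c, hc, hdef, hi⟩) hbelow habove
  choose h hh using hκ1
  choose f g hfg hpre hnull hpos using hκ2
  have hPx : P M x (Sum.elim h (Sum.elim f g)) := by
    have hpiece : ∀ y i, piece M (Sum.elim h (Sum.elim f g)) y i ↔ κ y = i := by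
      rintro y (l | t)
      · change y ∈ ({h l} : Set M) ↔ _
        rw [← hh]
        rfl
      · change y ∈ Set.Ioo (f t) (g t) ↔ _
        rw [← hpre]
        rfl
    refine ⟨fun y => ⟨κ y, (hpiece _ _).2 rfl, fun j hj => ((hpiece _ _).1 hj).symm⟩, fun t =>
      ⟨hfg t, fun h0 => (hnull t h0).imp (fun h y hy => ?_) id, fun h0 => ⟨?_, (hpos t h0).2⟩⟩⟩
    · have hy' : y ∈ Set.Ioo (f t) (g t) := hy
      simp [h] at hy'
    · have := (hpos t h0).1
      simp only [Sum.elim_inl, Sum.elim_inr]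
      omega
  obtain ⟨hpart, hint⟩ := hFP M x ⟨_, hPx⟩
  beta_reduce at hint ⊢
  refine ⟨fun y => hpart y, fun t => ⟨(hint t).1, fun h0 y hy => ?_, fun h0 => ⟨?_, ?_⟩⟩⟩
  · rcases (hint t).2.1 h0 with h | h
    · exact absurd hy (h y)
    · exact h.1 h0 y hy
  · have := ((hint t).2.2 h0).1
    omega
  · obtain ⟨hge, hle⟩ := (hint t).2.2 h0
    have hv := D.E_mem _ t.2.1.2 t.2.2
    change val t.2 ∈ _ at hv
    generalize F (Sum.inr (Sum.inl t)) M x = p at *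
    generalize F (Sum.inr (Sum.inr t)) M x = q at *
    have hn1 : (1 : ℝ) ≤ ((Set.Ioo p q).ncard : ℝ) := by
      exact_mod_cast (by omega : 1 ≤ (Set.Ioo p q).ncard)
    have hroot : (1 : ℝ) ≤ ((Set.Ioo p q).ncard : ℝ) ^ (1 / 2 : ℝ) :=
      Real.one_le_rpow hn1 (by norm_num)
    rcases hle with hle | ⟨-, c', hc', hdef', hsub⟩
    · have h1 : (({y | S M x y} ∩ Set.Ioo p q).ncard : ℝ) ≤ (Set.Ioo p q).ncard := by
        exact_mod_cast Set.ncard_le_ncard Set.inter_subset_right (Set.toFinite _)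
      have h2 : ((Set.Ioo p q).ncard : ℝ) ≤ 2 := by exact_mod_cast hle
      have h3 : (0 : ℝ) ≤ (({y | S M x y} ∩ Set.Ioo p q).ncard : ℝ) := Nat.cast_nonneg _
      have h4 : val t.2 * ((Set.Ioo p q).ncard : ℝ) ≤ 2 := by nlinarith [hv.1, hv.2]
      have h5 : 0 ≤ val t.2 * ((Set.Ioo p q).ncard : ℝ) := by
        have := hv.1
        positivity
      have hC := D.C_pos
      rw [abs_le]
      constructor <;> nlinarith
    · have hu := hall _ t.2.1.2 c' hc' hdef' t.2.2
      rw [hφ] at hu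
      rcases hu with h | h
      · exact absurd h.1 h0
      · refine (h.2 p q hsub).trans ?_
        gcongr
        · linarith

end FibrePartition

/-! ### Cells in finite structures -/

section Thick

variable {M : Type w} {n : ℕ} {ι : Fin n → Fin 2} {Z : Set (Fin n → M)}

/-- The coordinates of type `1` of a set, apart from the first, are not functions of the previous
ones. -/
def Thick (ι : Fin n → Fin 2) (Z : Set (Fin n → M)) : Prop :=
  ∀ j, ι j = 1 → (j : ℕ) ≠ 0 → ∃ x ∈ Z, ∃ y ∈ Z, (∀ i < j, x i = y i) ∧ x j ≠ y j

theorem Thick.graph (ht : Thick ι Z) (f : (Fin n → M) → M) :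
    Thick (Fin.snoc ι 0 : Fin (n + 1) → Fin 2)
      {p : Fin (n + 1) → M | Fin.init p ∈ Z ∧ p (Fin.last n) = f (Fin.init p)} := by
  intro j hj hj0
  induction j using Fin.lastCases with
  | last => simp at hj
  | cast j =>
    rw [Fin.snoc_castSucc] at hj
    obtain ⟨x, hx, y, hy, hxy, hne⟩ := ht j hj hj0
    refine ⟨Fin.snoc x (f x), by simpa using hx, Fin.snoc y (f y), by simpa using hy,
      fun i hi => ?_, by simpa using hne⟩
    induction i using Fin.lastCases with
    | last => exact absurd hi (Fin.le_last _).not_gt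
    | cast i => simpa using hxy i (Fin.castSucc_lt_castSucc_iff.1 hi)

end Thick

/-! ### Types, dimension and 1-cells -/

section Cells

variable {L : FirstOrder.Language.{u, v}} {Δ : MeasureSystem L} {M : Type w} [L.Structure M]

/-- With all elements of `M` as parameters, points are definable, and a finite set is a finite union
of points. The definability demanded of the functions bounding a cell is thus automatic in each
single structure. -/
theorem definable_of_finite [Finite M] {n : ℕ} (s : Set (Fin n → M)) :
    (Set.univ : Set M).Definable L s := by
  have h1 : ∀ x : Fin n → M, (Set.univ : Set M).Definable L {x} := by
    intro x
    have : ({x} : Set (Fin n → M)) =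
        ⋂ i : Fin n, (fun y : Fin n → M => y ∘ fun _ : Fin 1 => i) ⁻¹' {z | z 0 = x i} := by
      ext y
      simp [funext_iff]
    rw [this]
    refine Set.definable_iInter_of_finite fun i => Set.Definable.preimage_comp _ ?_
    exact Set.Definable.singleton_of_mem L (Set.mem_univ (x i))
  rw [← Set.biUnion_of_singleton s, Set.biUnion_eq_iUnion]
  exact Set.definable_iUnion_of_finite fun x => h1 _

theorem isDefinableFun_of_finite [Finite M] {n : ℕ} (f : (Fin n → M) → M) : IsDefinableFun L f :=
  definable_of_finite _

variable [LinearOrder M] {n : ℕ} {ι : Fin n → Fin 2} {Z : Set (Fin n → M)}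

theorem IsCell.pos (h : IsCell Δ M ι Z) : 0 < n := by
  induction h with
  | interval => exact one_pos
  | inter _ _ _ _ _ _ ih => exact ih
  | graph => exact Nat.succ_pos _
  | band => exact Nat.succ_pos _

/-- Every construction of a cell starts from an interval. This is why `Thick` can leave out the
first coordinate. -/
theorem IsCell.first_eq_one (h : IsCell Δ M ι Z) (hn : 0 < n) : ι ⟨0, hn⟩ = 1 := by
  induction h with
  | interval => rfl
  | inter _ _ _ _ _ _ ih => exact ih hn
  | @graph n ι X hX f hf ih =>
    have := ih hX.pos
    rwa [show (⟨0, hn⟩ : Fin (n + 1)) = Fin.castSucc ⟨0, hX.pos⟩ from rfl, Fin.snoc_castSucc]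
  | @band n ι X hX f g hf hg hfg ih =>
    have := ih hX.pos
    rwa [show (⟨0, hn⟩ : Fin (n + 1)) = Fin.castSucc ⟨0, hX.pos⟩ from rfl, Fin.snoc_castSucc]

/-- In a cell the coordinates of type `0` are functions of the previous ones. -/
theorem IsCell.eq_of_type_zero (h : IsCell Δ M ι Z) (j : Fin n) (hj : ι j = 0) :
    ∀ x ∈ Z, ∀ y ∈ Z, (∀ i < j, x i = y i) → x j = y j := by
  induction h with
  | interval => exact absurd hj one_ne_zero
  | inter _ _ _ _ _ _ ih => exact fun x hx y hy => ih j hj x hx.1 y hy.1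
  | @graph n ι X hX f hf ih =>
    intro x hx y hy hxy
    induction j using Fin.lastCases with
    | last =>
      rw [hx.2, hy.2]
      congr 1
      ext i
      exact hxy _ (Fin.castSucc_lt_last i)
    | cast j =>
      rw [Fin.snoc_castSucc] at hj
      exact ih j hj _ hx.1 _ hy.1 fun i hi => hxy _ (Fin.castSucc_lt_castSucc_iff.2 hi)
  | @band n ι X hX f g hf hg hfg ih =>
    intro x hx y hy hxy
    induction j using Fin.lastCases with
    | last => simp at hj
    | cast j =>
      rw [Fin.snoc_castSucc] at hj
      exact ih j hj _ hx.1 _ hy.1 fun i hi => hxy _ (Fin.castSucc_lt_castSucc_iff.2 hi)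

theorem IsCell.one_le_sum (h : IsCell Δ M ι Z) : 1 ≤ ∑ j, (ι j : ℕ) := by
  have := h.first_eq_one h.pos
  calc 1 = (ι ⟨0, h.pos⟩ : ℕ) := by rw [this]; rfl
    _ ≤ _ := Finset.single_le_sum (f := fun j => (ι j : ℕ)) (fun _ _ => Nat.zero_le _)
      (Finset.mem_univ _)

/-- No type of `Z` can have a `0` where `ι` has a `1`: the first entry is always `1`, and elsewhere
a `0` would make the coordinate a function of the earlier ones. Hence `ι` has the least sum. -/
theorem cellDim_eq_of_thick (h : IsCell Δ M ι Z) (ht : Thick ι Z) :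
    cellDim Δ Z = ∑ j, (ι j : ℕ) := by
  refine le_antisymm (Nat.sInf_le ⟨ι, h, rfl⟩) (le_csInf ⟨_, ι, h, rfl⟩ ?_)
  rintro _ ⟨ι', h', rfl⟩
  refine Finset.sum_le_sum fun j _ => ?_
  have hle : ∀ a b : Fin 2, (a = 1 → b = 1) → (a : ℕ) ≤ b := by decide
  refine hle _ _ fun hj => ?_
  by_cases hj0 : (j : ℕ) = 0
  · rw [show j = ⟨0, h.pos⟩ from Fin.ext hj0]
    exact h'.first_eq_one _
  · obtain ⟨x, hx, y, hy, hxy, hne⟩ := ht j hj hj0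
    have h2 : ∀ a : Fin 2, a ≠ 0 → a = 1 := by decide
    exact h2 _ fun h0 => hne (h'.eq_of_type_zero j h0 x hx y hy hxy)

/-- A coordinate of type `1` contributes at most a factor `|M|`, and one of type `0` contributes
nothing. -/
theorem IsCell.ncard_le [Finite M] (h : IsCell Δ M ι Z) :
    Z.ncard ≤ Nat.card M ^ ∑ j, (ι j : ℕ) := by
  induction h with
  | interval I hI =>
    refine (Set.ncard_le_card _).trans ?_
    simp [Nat.card_fun]
  | inter hX φ μ hμ d hne ih => exact (Set.ncard_le_ncard Set.inter_subset_left (Set.toFinite _)).trans ih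
  | @graph n ι X hX f hf ih =>
    rw [Fin.sum_univ_castSucc]
    simp only [Fin.snoc_castSucc, Fin.snoc_last, Fin.val_zero, add_zero]
    refine le_trans (Set.ncard_le_ncard_of_injOn Fin.init (fun p hp => hp.1) ?_ (Set.toFinite _)) ih
    intro p hp q hq hpq
    rw [← Fin.snoc_init_self p, ← Fin.snoc_init_self q, hp.2, hq.2, hpq]
  | @band n ι X hX f g hf hg hfg ih =>
    rw [Fin.sum_univ_castSucc]
    simp only [Fin.snoc_castSucc, Fin.snoc_last, Fin.val_one, pow_succ]
    calc _ ≤ (X ×ˢ (Set.univ : Set M)).ncard :=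
          Set.ncard_le_ncard_of_injOn (fun p => (Fin.init p, p (Fin.last n)))
            (fun p hp => ⟨hp.1, trivial⟩) (fun p _ q _ hpq => by
              rw [← Fin.snoc_init_self p, ← Fin.snoc_init_self q]
              obtain ⟨h1, h2⟩ := Prod.ext_iff.1 hpq
              dsimp only at h1 h2
              rw [h1, h2]) (Set.toFinite _)
      _ = X.ncard * Nat.card M := by rw [Set.ncard_prod, Set.ncard_univ]
      _ ≤ _ := Nat.mul_le_mul_right _ ih

theorem isOpenInterval_singleton [Finite M] (a : M) : IsOpenInterval ({a} : Set M) := by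
  refine ⟨Set.singleton_nonempty a, ?_⟩
  have hlow : (∃ b, b < a ∧ ∀ z, b < z → a ≤ z) ∨ ∀ z, a ≤ z := by
    by_cases h : ∃ b, b < a
    · obtain ⟨b, hb, hmax⟩ := Set.exists_max_image {b | b < a} id (Set.toFinite _) h
      exact Or.inl ⟨b, hb, fun z hz => not_lt.1 fun h' => (hmax z h').not_gt hz⟩
    · push Not at h
      exact Or.inr h
  have hhigh : (∃ b, a < b ∧ ∀ z, z < b → z ≤ a) ∨ ∀ z, z ≤ a := by
    by_cases h : ∃ b, a < b
    · obtain ⟨b, hb, hmin⟩ := Set.exists_min_image {b | a < b} id (Set.toFinite _) h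
      exact Or.inl ⟨b, hb, fun z hz => not_lt.1 fun h' => (hmin z h').not_gt hz⟩
    · push Not at h
      exact Or.inr h
  rcases hlow with ⟨b, hb, hb'⟩ | hb' <;> rcases hhigh with ⟨c, hc, hc'⟩ | hc'
  · refine Or.inl ⟨b, c, Set.ext fun z => ⟨?_, fun hz => le_antisymm (hc' z hz.2) (hb' z hz.1)⟩⟩
    rintro rfl
    exact ⟨hb, hc⟩
  · refine Or.inr (Or.inr (Or.inl ⟨b, Set.ext fun z =>
      ⟨?_, fun hz => le_antisymm (hc' z) (hb' z hz)⟩⟩))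
    rintro rfl
    exact hb
  · refine Or.inr (Or.inl ⟨c, Set.ext fun z => ⟨?_, fun hz => le_antisymm (hc' z hz) (hb' z)⟩⟩)
    rintro rfl
    exact hc
  · exact Or.inr (Or.inr (Or.inr (Set.ext fun z =>
      ⟨fun _ => trivial, fun _ => le_antisymm (hc' z) (hb' z)⟩)))

theorem isCell_singleton [Finite M] {n : ℕ} (x : Fin (n + 1) → M) :
    ∃ ι, IsCell Δ M ι ({x} : Set (Fin (n + 1) → M)) := by
  induction n with
  | zero =>
    refine ⟨_, (?_ : {x} = {y : Fin 1 → M | y 0 ∈ ({x 0} : Set M)}) ▸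
      IsCell.interval _ (isOpenInterval_singleton (x 0))⟩
    ext y
    simp [funext_iff]
  | succ n ih =>
    obtain ⟨ι, hι⟩ := ih (Fin.init x)
    refine ⟨_, (?_ : {x} = {y : Fin (n + 2) → M | Fin.init y ∈ ({Fin.init x} : Set _) ∧
      y (Fin.last _) = x (Fin.last _)}) ▸ hι.graph (fun _ => x (Fin.last _))
        (isDefinableFun_of_finite _)⟩
    ext y
    constructor
    · rintro rfl
      exact ⟨rfl, rfl⟩
    · rintro ⟨h1, h2⟩
      rw [Set.mem_singleton_iff] at h1 ⊢
      rw [← Fin.snoc_init_self y, ← Fin.snoc_init_self x, h1, h2]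

/-- Two elements in a fibre show that the last coordinate is free. Nonempty fibres allow the
witnesses for earlier coordinates to be lifted. -/
theorem Thick.band (ht : Thick ι Z) (hne : Z.Nonempty) {f g : (Fin n → M) → M}
    (hfg : ∀ x ∈ Z, 2 ≤ (Set.Ioo (f x) (g x)).ncard) :
    Thick (Fin.snoc ι 1 : Fin (n + 1) → Fin 2)
      {p : Fin (n + 1) → M | Fin.init p ∈ Z ∧ f (Fin.init p) < p (Fin.last n) ∧
        p (Fin.last n) < g (Fin.init p)} := by
  have hmem : ∀ x ∈ Z, ∃ y, y ∈ Set.Ioo (f x) (g x) := fun x hx =>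
    Set.nonempty_of_ncard_ne_zero (by have := hfg x hx; omega)
  intro j hj hj0
  induction j using Fin.lastCases with
  | last =>
    obtain ⟨x, hx⟩ := hne
    obtain ⟨a, b, ha, hb, hab⟩ := (Set.one_lt_ncard_iff
      (Set.finite_of_ncard_ne_zero (by have := hfg x hx; omega))).1 (hfg x hx)
    refine ⟨Fin.snoc x a, by simpa using ⟨hx, ha⟩, Fin.snoc x b, by simpa using ⟨hx, hb⟩,
      fun i hi => ?_, by simpa using hab⟩
    induction i using Fin.lastCases with
    | last => exact absurd hi (lt_irrefl _)
    | cast i => simp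
  | cast j =>
    rw [Fin.snoc_castSucc] at hj
    obtain ⟨x, hx, y, hy, hxy, hne⟩ := ht j hj hj0
    obtain ⟨a, ha⟩ := hmem x hx
    obtain ⟨b, hb⟩ := hmem y hy
    refine ⟨Fin.snoc x a, by simpa using ⟨hx, ha⟩, Fin.snoc y b, by simpa using ⟨hy, hb⟩,
      fun i hi => ?_, by simpa using hne⟩
    induction i using Fin.lastCases with
    | last => exact absurd hi (Fin.le_last _).not_gt
    | cast i => simpa using hxy i (Fin.castSucc_lt_castSucc_iff.1 hi)

theorem IsOneCell.exists_graph {Y : Set (Fin n → M)} (hY : IsOneCell Y) (f : (Fin n → M) → M) :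
    ∃ Y' : Set (Fin (n + 1) → M), IsOneCell Y' ∧ Y'.ncard = Y.ncard ∧
      ∀ p ∈ Y', Fin.init p ∈ Y ∧ p (Fin.last n) = f (Fin.init p) := by
  obtain ⟨j, I, hI, hbij⟩ := hY
  have hinj : Function.Injective fun x : Fin n → M => (Fin.snoc x (f x) : Fin (n + 1) → M) :=
    fun x y h => by simpa using congrArg Fin.init h
  refine ⟨(fun x : Fin n → M => (Fin.snoc x (f x) : Fin (n + 1) → M)) '' Y,
    ⟨j.castSucc, I, hI, ?_, ?_, ?_⟩, Set.ncard_image_of_injective _ hinj, ?_⟩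
  · rintro _ ⟨x, hx, rfl⟩
    simpa using hbij.mapsTo hx
  · rintro _ ⟨x, hx, rfl⟩ _ ⟨y, hy, rfl⟩ h
    have : x = y := hbij.injOn hx hy (by simpa using h)
    rw [this]
  · intro a ha
    obtain ⟨x, hx, rfl⟩ := hbij.surjOn ha
    exact ⟨_, ⟨x, hx, rfl⟩, by simp⟩
  · rintro _ ⟨x, hx, rfl⟩
    simpa using hx

/-- One point is picked over each value of the first coordinate; a 1-cell need not be definable
uniformly. -/
theorem exists_isOneCell_of_surj [Nonempty M] {n : ℕ} {Z : Set (Fin (n + 1) → M)}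
    (h : ∀ a, ∃ z ∈ Z, z 0 = a) : ∃ Y ⊆ Z, IsOneCell Y ∧ Y.ncard = Nat.card M := by
  choose z hz hz0 using h
  have hinj : Function.Injective z := fun a b hab => by rw [← hz0 a, ← hz0 b, hab]
  refine ⟨Set.range z, by rintro _ ⟨a, rfl⟩; exact hz a, ⟨0, Set.univ,
    ⟨Set.univ_nonempty, Or.inr (Or.inr (Or.inr rfl))⟩, fun _ _ => trivial, ?_,
    fun a _ => ⟨z a, ⟨a, rfl⟩, hz0 a⟩⟩, ?_⟩
  · rintro _ ⟨a, rfl⟩ _ ⟨b, rfl⟩ hab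
    simp only [hz0] at hab
    rw [hab]
  · rw [← Set.image_univ, Set.ncard_image_of_injective _ hinj, Set.ncard_univ]

theorem exists_isMaxOneCell [Finite M] {Y Z : Set (Fin n → M)} (hY : IsOneCell Y) (hYZ : Y ⊆ Z) :
    ∃ Y', IsMaxOneCell Y' Z ∧ Y.ncard ≤ Y'.ncard := by
  obtain ⟨Y', hY', hmax⟩ := Set.exists_max_image {Y | IsOneCell Y ∧ Y ⊆ Z} Set.ncard
    (Set.toFinite _) ⟨Y, hY, hYZ⟩
  exact ⟨Y', ⟨hY'.1, hY'.2, fun W hW hWZ => hmax W ⟨hW, hWZ⟩⟩, hmax Y ⟨hY, hYZ⟩⟩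

end Cells

/-! ### Boxes -/

section Boxes

variable {L : FirstOrder.Language.{u, v}} {lt : L.Relations 2}

/-- The space `M^(n+1)` is uniformly partitioned into cells, each of which projects onto the first
coordinate. -/
theorem exists_box_decomposition (Δ : MeasureSystem L) (n : ℕ) :
    ∃ (κ : Type) (_ : Finite κ) (B : κ → ∀ M : FinOrdStructure.{u, v, w} L lt, Set (Fin (n + 1) → M)),
      (∀ k, UnifDef fun M x => x ∈ B k M) ∧
      ∀ M : FinOrdStructure.{u, v, w} L lt, 4 ≤ Nat.card M → (∀ x, ∃! k, x ∈ B k M) ∧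
        ∀ k, ∃ ι, IsCell Δ M ι (B k M) ∧ Thick ι (B k M) ∧ ∀ a, ∃ z ∈ B k M, z 0 = a := by
  induction n with
  | zero =>
    refine ⟨Unit, inferInstance, fun _ _ => Set.univ, fun _ => UnifDef.const True, fun M _ =>
      ⟨fun x => ⟨(), trivial, fun _ _ => rfl⟩, fun _ => ⟨fun _ => 1, ?_, ?_, ?_⟩⟩⟩
    · exact IsCell.interval Set.univ ⟨Set.univ_nonempty, Or.inr (Or.inr (Or.inr rfl))⟩
    · exact fun j _ hj => absurd (by omega) hj
    · exact fun a => ⟨fun _ => a, trivial, rfl⟩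
  | succ n ih =>
    obtain ⟨κ, _, B, hB, hcells⟩ := ih
    -- The new coordinate is the minimum, the maximum or strictly between them. With at least four
    -- elements in `M` the third piece has fibres of size at least two, as `Thick.band` needs.
    let B' : κ × Fin 3 → ∀ M : FinOrdStructure.{u, v, w} L lt, Set (Fin (n + 2) → M) := fun k M =>
      {p | Fin.init p ∈ B k.1 M ∧ ![∀ y, p (Fin.last _) ≤ y, ∀ y, y ≤ p (Fin.last _),
        (¬ ∀ y, p (Fin.last _) ≤ y) ∧ ¬ ∀ y, y ≤ p (Fin.last _)] k.2}
    refine ⟨κ × Fin 3, inferInstance, B', ?_, fun M hM => ?_⟩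
    · rintro ⟨k, i⟩
      have hbot : UnifDef fun (M : FinOrdStructure.{u, v, w} L lt) (p : Fin (n + 2) → M) =>
          ∀ y, p (Fin.last _) ≤ y := UnifDef.forall_elem
        ((UnifDefFun.var (γ := Fin (n + 2) ⊕ Unit) (Sum.inl (Fin.last _))).rel_le
          (UnifDefFun.var (Sum.inr ())))
      have htop : UnifDef fun (M : FinOrdStructure.{u, v, w} L lt) (p : Fin (n + 2) → M) =>
          ∀ y, y ≤ p (Fin.last _) := UnifDef.forall_elem
        ((UnifDefFun.var (γ := Fin (n + 2) ⊕ Unit) (Sum.inr ())).rel_le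
          (UnifDefFun.var (Sum.inl (Fin.last _))))
      refine ((hB k).comap Fin.castSucc).and ?_
      fin_cases i
      · exact hbot
      · exact htop
      · exact hbot.not.and htop.not
    · obtain ⟨hpart, hcell⟩ := hcells M hM
      obtain ⟨b, hb⟩ : ∃ b : M, ∀ y, b ≤ y := Finite.exists_min id
      obtain ⟨t, ht⟩ : ∃ t : M, ∀ y, y ≤ t := Finite.exists_max id
      have hbe : ∀ a : M, (∀ y, a ≤ y) ↔ a = b := fun a =>
        ⟨fun h => le_antisymm (h b) (hb a), fun h => h ▸ hb⟩
      have hte : ∀ a : M, (∀ y, y ≤ a) ↔ a = t := fun a =>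
        ⟨fun h => le_antisymm (ht a) (h t), fun h => h ▸ ht⟩
      have hcard : 2 ≤ (Set.Ioo b t).ncard := by
        have huniv : (Set.univ : Set M) ⊆ insert b (insert t (Set.Ioo b t)) := fun y _ => by
          rcases (hb y).eq_or_lt with h | h
          · exact Or.inl h.symm
          rcases (ht y).eq_or_lt with h' | h'
          · exact Or.inr (Or.inl h')
          · exact Or.inr (Or.inr ⟨h, h'⟩)
        have h1 := Set.ncard_le_ncard huniv (Set.toFinite _)
        have h2 := Set.ncard_insert_le b (insert t (Set.Ioo b t))
        have h3 := Set.ncard_insert_le t (Set.Ioo b t)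
        rw [Set.ncard_univ] at h1
        omega
      have hbt : b ≠ t := by
        rintro rfl
        simp at hcard
      have hB0 : ∀ k, B' (k, 0) M =
          {p : Fin (n + 2) → M | Fin.init p ∈ B k M ∧ p (Fin.last _) = (fun _ => b) (Fin.init p)} := fun k => by
        simp [B', hbe]
      have hB1 : ∀ k, B' (k, 1) M =
          {p : Fin (n + 2) → M | Fin.init p ∈ B k M ∧ p (Fin.last _) = (fun _ => t) (Fin.init p)} := fun k => by
        simp [B', hte]
      have hB2 : ∀ k, B' (k, 2) M = {p : Fin (n + 2) → M | Fin.init p ∈ B k M ∧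
          (fun _ => b) (Fin.init p) < p (Fin.last _) ∧
            p (Fin.last _) < (fun _ => t) (Fin.init p)} := fun k => by
        ext p
        simp only [B', hbe, hte, Set.mem_ofPred_eq, Matrix.cons_val]
        rw [(hb _).lt_iff_ne', (ht _).lt_iff_ne]
      have hsurj : ∀ k (c : M) i, (∀ x ∈ B k M, (Fin.snoc x c : Fin (n + 2) → M) ∈ B' (k, i) M) →
          ∀ a, ∃ z ∈ B' (k, i) M, z 0 = a := fun k c i h a => by
        obtain ⟨ι, -, -, hs⟩ := hcell k
        obtain ⟨z, hz, rfl⟩ := hs a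
        exact ⟨_, h z hz, by rw [← Fin.castSucc_zero, Fin.snoc_castSucc]⟩
      refine ⟨fun p => ?_, ?_⟩
      · obtain ⟨k, hk, huniq⟩ := hpart (Fin.init p)
        have hi : ∃! i : Fin 3, ![p (Fin.last _) = b, p (Fin.last _) = t,
            ¬ p (Fin.last _) = b ∧ ¬ p (Fin.last _) = t] i := by
          by_cases h1 : p (Fin.last _) = b
          · refine ⟨0, h1, fun i hi => ?_⟩
            fin_cases i
            · rfl
            · exact absurd (h1.symm.trans hi) hbt
            · exact absurd h1 hi.1
          by_cases h2 : p (Fin.last _) = t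
          · refine ⟨1, h2, fun i hi => ?_⟩
            fin_cases i
            · exact absurd hi h1
            · rfl
            · exact absurd h2 hi.2
          · refine ⟨2, ⟨h1, h2⟩, fun i hi => ?_⟩
            fin_cases i
            · exact absurd hi h1
            · exact absurd hi h2
            · rfl
        obtain ⟨i, hi, hiu⟩ := hi
        refine ⟨(k, i), ⟨hk, by simpa only [hbe, hte] using hi⟩, ?_⟩
        rintro ⟨k', i'⟩ ⟨hk', hi'⟩
        rw [huniq k' hk', hiu i' (by simpa only [hbe, hte] using hi')]
      · rintro ⟨k, i⟩
        obtain ⟨ι, hι, hthick, hs⟩ := hcell k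
        fin_cases i
        · refine ⟨Fin.snoc ι 0, ?_, ?_, hsurj k b 0 fun x hx => ?_⟩
          · exact hB0 k ▸ hι.graph (fun _ => b) (isDefinableFun_of_finite _)
          · exact hB0 k ▸ hthick.graph fun _ => b
          · rw [hB0]
            simpa using hx
        · refine ⟨Fin.snoc ι 0, ?_, ?_, hsurj k t 1 fun x hx => ?_⟩
          · exact hB1 k ▸ hι.graph (fun _ => t) (isDefinableFun_of_finite _)
          · exact hB1 k ▸ hthick.graph fun _ => t
          · rw [hB1]
            simpa using hx
        · obtain ⟨c, hc⟩ := Set.nonempty_of_ncard_ne_zero (s := Set.Ioo b t) (by omega)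
          refine ⟨Fin.snoc ι 1, ?_, ?_, hsurj k c 2 fun x hx => ?_⟩
          · exact hB2 k ▸ hι.band _ _ (isDefinableFun_of_finite _) (isDefinableFun_of_finite _)
              fun _ _ => hc.1.trans hc.2
          · obtain ⟨z, hz, -⟩ := hs b
            exact hB2 k ▸ hthick.band ⟨z, hz⟩ fun _ _ => hcard
          · rw [hB2]
            simpa using ⟨hx, hc⟩

end Boxes

/-! ### Uniform cell decompositions -/

section CellDecomposition

variable {L : FirstOrder.Language.{u, v}} {lt : L.Relations 2} {γ : Type}

/-- The cell `Z` has density `α` for `S`, with the error measured by a `1`-cell in `Z` and by a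
type of `Z` for which `Z` is thick (so that the dimension of `Z` can be read off from the type). -/
def HasCellDensity (Δ : MeasureSystem L) {M : Type w} [L.Structure M] [LinearOrder M] {n : ℕ}
    (S : Set (Fin n → M)) (C α : ℝ) (Z : Set (Fin n → M)) : Prop :=
  (α = 0 ∧ (∃ ι, IsCell Δ M ι Z) ∧ ((S ∩ Z).ncard : ℝ) ≤ C) ∨
  (α ≠ 0 ∧ ∃ ι, IsCell Δ M ι Z ∧ Thick ι Z ∧ ∃ Y, IsOneCell Y ∧ Y ⊆ Z ∧
    |((S ∩ Z).ncard : ℝ) - α * (Z.ncard : ℝ)|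
      ≤ C * (Y.ncard : ℝ) ^ (((∑ j, (ι j : ℕ) : ℕ) : ℝ) - 1 / 2))

/-- The family `S` has a uniformly definable cell decomposition in which each cell has a fixed
density. Which of the cells are empty, and so which densities occur, depends on the structure
and on the parameters. -/
def HasUnifCellDecomposition (Δ : MeasureSystem L) (𝒞 : Set (FinOrdStructure.{u, v, w} L lt)) {n : ℕ}
    (S : ∀ M : FinOrdStructure.{u, v, w} L lt, (γ → M) → Set (Fin n → M)) : Prop :=
  ∃ (κ : Type) (_ : Finite κ) (α : κ → ℝ) (C : ℝ)
    (Z : κ → ∀ M : FinOrdStructure.{u, v, w} L lt, (γ → M) → Set (Fin n → M)),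
    0 < C ∧ (∀ k, α k ∈ Set.Icc (0 : ℝ) 1) ∧
    (∀ k, UnifDef fun M (x : γ ⊕ Fin n → M) => x ∘ Sum.inr ∈ Z k M (x ∘ Sum.inl)) ∧
    ∀ M ∈ 𝒞, ∀ a, (∀ x, ∃! k, x ∈ Z k M a) ∧
      ∀ k, (Z k M a).Nonempty → HasCellDensity Δ (S M a) C (α k) (Z k M a)

/-! ### Densities of points, graphs and bands -/

section Density

variable {Δ : MeasureSystem L} {M : Type w} [L.Structure M] [LinearOrder M] {n : ℕ}

theorem HasCellDensity.mono {S Z : Set (Fin n → M)} {C C' α : ℝ} (h : HasCellDensity Δ S C α Z)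
    (hC : C ≤ C') : HasCellDensity Δ S C' α Z := by
  rcases h with ⟨h0, hι, h⟩ | ⟨h0, ι, hι, ht, Y, hY, hYZ, h⟩
  · exact Or.inl ⟨h0, hι, h.trans hC⟩
  · refine Or.inr ⟨h0, ι, hι, ht, Y, hY, hYZ, h.trans ?_⟩
    gcongr

theorem hasCellDensity_singleton [Finite M] (S : Set (Fin (n + 1) → M)) (x : Fin (n + 1) → M) :
    HasCellDensity Δ S 1 0 {x} := by
  refine Or.inl ⟨rfl, isCell_singleton x, ?_⟩
  have h : (S ∩ {x}).ncard ≤ 1 :=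
    (Set.ncard_le_ncard Set.inter_subset_right (Set.toFinite _)).trans (Set.ncard_singleton x).le
  exact_mod_cast h

/-- The map `x ↦ (x, f x)` preserves all cardinalities, sends 1-cells to 1-cells and adds `0` to the
sum of the type, so the estimate carries over with the same constant. -/
theorem HasCellDensity.graph [Finite M] {S : Set (Fin (n + 1) → M)} {W : Set (Fin n → M)}
    {C α : ℝ} {f : (Fin n → M) → M}
    (h : HasCellDensity Δ {x | (Fin.snoc x (f x) : Fin (n + 1) → M) ∈ S} C α W) :
    HasCellDensity Δ S C α {p | Fin.init p ∈ W ∧ p (Fin.last n) = f (Fin.init p)} := by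
  have himage : ∀ A : Set (Fin (n + 1) → M), (A ∩ {p | Fin.init p ∈ W ∧
      p (Fin.last n) = f (Fin.init p)}).ncard =
        ({x | (Fin.snoc x (f x) : Fin (n + 1) → M) ∈ A} ∩ W).ncard := by
    intro A
    have hinj : Function.Injective fun x : Fin n → M => (Fin.snoc x (f x) : Fin (n + 1) → M) :=
      fun x y h => by simpa using congrArg Fin.init h
    rw [← Set.ncard_image_of_injective _ hinj]
    congr 1
    ext p
    constructor
    · rintro ⟨hpA, hpW, hp⟩
      have hp' : (Fin.snoc (Fin.init p) (f (Fin.init p)) : Fin (n + 1) → M) = p := by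
        rw [← hp, Fin.snoc_init_self]
      exact ⟨Fin.init p, ⟨by rwa [Set.mem_ofPred_eq, hp'], hpW⟩, hp'⟩
    · rintro ⟨x, ⟨hxA, hxW⟩, rfl⟩
      exact ⟨hxA, by simpa using hxW⟩
  rcases h with ⟨h0, ⟨ι, hι⟩, h⟩ | ⟨h0, ι, hι, ht, Y, hY, hYZ, h⟩
  · exact Or.inl ⟨h0, ⟨_, hι.graph f (isDefinableFun_of_finite f)⟩, by rwa [himage]⟩
  · obtain ⟨Y', hY', hcard, hsub⟩ := hY.exists_graph f
    refine Or.inr ⟨h0, _, hι.graph f (isDefinableFun_of_finite f), ht.graph f, Y', hY',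
      fun p hp => ⟨hYZ (hsub p hp).1, (hsub p hp).2⟩, ?_⟩
    have hZ := himage Set.univ
    simp only [Set.univ_inter, Set.mem_univ, Set.ofPred_true] at hZ
    rw [himage, hZ, hcard, Fin.sum_univ_castSucc]
    simpa using h

theorem ncard_eq_sum_fibre [Finite M] [Fintype (Fin n → M)] (W : Set (Fin (n + 1) → M)) :
    W.ncard = ∑ x : Fin n → M, {y | (Fin.snoc x y : Fin (n + 1) → M) ∈ W}.ncard := by
  classical
  have hW : W.Finite := Set.toFinite _
  rw [Set.ncard_eq_toFinset_card W hW,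
    Finset.card_eq_sum_card_fiberwise (f := Fin.init) (t := Finset.univ) fun _ _ => by simp]
  refine Finset.sum_congr rfl fun x _ => ?_
  have hinj : Function.Injective fun y : M => (Fin.snoc x y : Fin (n + 1) → M) := fun y z h => by
    simpa using congrFun h (Fin.last n)
  rw [← Set.ncard_image_of_injective _ hinj, ← Set.ncard_coe_finset]
  congr 1
  ext p
  constructor
  · intro hp
    obtain ⟨hpW, rfl⟩ : p ∈ W ∧ Fin.init p = x := by simpa using hp
    exact ⟨p (Fin.last n), by rwa [Set.mem_ofPred_eq, Fin.snoc_init_self], Fin.snoc_init_self p⟩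
  · rintro ⟨y, hy, rfl⟩
    simpa using hy

/-- Count fibre by fibre over `B` and use the triangle inequality; each fibre errs by at most
`C|M|^(1/2)`. -/
theorem abs_ncard_band_sub_le [Finite M] {B : Set (Fin n → M)} {f g : (Fin n → M) → M}
    {S : Set (Fin (n + 1) → M)} {α C : ℝ} (hC : 0 ≤ C)
    (h : ∀ x ∈ B, |(({y | (Fin.snoc x y : Fin (n + 1) → M) ∈ S} ∩ Set.Ioo (f x) (g x)).ncard : ℝ)
      - α * ((Set.Ioo (f x) (g x)).ncard : ℝ)|
        ≤ C * ((Set.Ioo (f x) (g x)).ncard : ℝ) ^ (1 / 2 : ℝ)) :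
    |((S ∩ {p | Fin.init p ∈ B ∧ f (Fin.init p) < p (Fin.last n) ∧
        p (Fin.last n) < g (Fin.init p)}).ncard : ℝ)
      - α * (({p : Fin (n + 1) → M | Fin.init p ∈ B ∧ f (Fin.init p) < p (Fin.last n) ∧
        p (Fin.last n) < g (Fin.init p)}).ncard : ℝ)|
      ≤ B.ncard * (C * (Nat.card M : ℝ) ^ (1 / 2 : ℝ)) := by
  classical
  have := Fintype.ofFinite (Fin n → M)
  rw [ncard_eq_sum_fibre, ncard_eq_sum_fibre, Nat.cast_sum, Nat.cast_sum, Finset.mul_sum,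
    ← Finset.sum_sub_distrib]
  refine (Finset.abs_sum_le_sum_abs _ _).trans ?_
  calc _ ≤ ∑ x : Fin n → M, if x ∈ B then C * (Nat.card M : ℝ) ^ (1 / 2 : ℝ) else 0 := by
        refine Finset.sum_le_sum fun x _ => ?_
        by_cases hx : x ∈ B
        · rw [if_pos hx]
          have h1 : {y | (Fin.snoc x y : Fin (n + 1) → M) ∈ S ∩ {p | Fin.init p ∈ B ∧
              f (Fin.init p) < p (Fin.last n) ∧ p (Fin.last n) < g (Fin.init p)}} =
              {y | (Fin.snoc x y : Fin (n + 1) → M) ∈ S} ∩ Set.Ioo (f x) (g x) := by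
            ext y
            simp [hx]
          have h2 : {y | (Fin.snoc x y : Fin (n + 1) → M) ∈ {p : Fin (n + 1) → M | Fin.init p ∈ B ∧
              f (Fin.init p) < p (Fin.last n) ∧ p (Fin.last n) < g (Fin.init p)}} =
              Set.Ioo (f x) (g x) := by
            ext y
            simp [hx]
          rw [h1, h2]
          refine (h x hx).trans ?_
          gcongr
          exact Set.ncard_le_card _
        · simp [hx]
    _ = B.ncard * (C * (Nat.card M : ℝ) ^ (1 / 2 : ℝ)) := by
        rw [← Finset.sum_filter, Finset.sum_const, nsmul_eq_mul, ← Set.ncard_coe_finset]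
        simp

/-- Since `B` projects onto the first coordinate and the fibres are nonempty when `α ≠ 0`, the band
contains a 1-cell of size `|M|`. This turns the bound `|B| * C|M|^(1/2)` into the required power of
a 1-cell. -/
theorem hasCellDensity_band [Finite M] [Nonempty M] {B : Set (Fin (n + 1) → M)}
    {ι : Fin (n + 1) → Fin 2} (hB : IsCell Δ M ι B) (ht : Thick ι B)
    (hsurj : ∀ a, ∃ z ∈ B, z 0 = a) {f g : (Fin (n + 1) → M) → M} (hfg : ∀ x ∈ B, f x < g x)
    {S : Set (Fin (n + 2) → M)} {α C : ℝ} (hC : 0 ≤ C)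
    (h0 : α = 0 → ∀ x ∈ B, ∀ y ∈ Set.Ioo (f x) (g x), (Fin.snoc x y : Fin (n + 2) → M) ∉ S)
    (h1 : α ≠ 0 → ∀ x ∈ B, 2 ≤ (Set.Ioo (f x) (g x)).ncard ∧
      |(({y | (Fin.snoc x y : Fin (n + 2) → M) ∈ S} ∩ Set.Ioo (f x) (g x)).ncard : ℝ)
        - α * ((Set.Ioo (f x) (g x)).ncard : ℝ)|
          ≤ C * ((Set.Ioo (f x) (g x)).ncard : ℝ) ^ (1 / 2 : ℝ)) :
    HasCellDensity Δ S C α {p | Fin.init p ∈ B ∧ f (Fin.init p) < p (Fin.last _) ∧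
      p (Fin.last _) < g (Fin.init p)} := by
  have hcell := hB.band f g (isDefinableFun_of_finite f) (isDefinableFun_of_finite g) hfg
  by_cases hα : α = 0
  · refine Or.inl ⟨hα, ⟨_, hcell⟩, ?_⟩
    have : S ∩ {p | Fin.init p ∈ B ∧ f (Fin.init p) < p (Fin.last _) ∧
        p (Fin.last _) < g (Fin.init p)} = ∅ := by
      rw [Set.eq_empty_iff_forall_notMem]
      rintro p ⟨hpS, hpB, hp⟩
      exact h0 hα _ hpB _ hp (by rwa [Fin.snoc_init_self])
    rw [this]
    simpa using hC
  · obtain ⟨z, hz, -⟩ := hsurj (Classical.arbitrary M)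
    obtain ⟨Y, hYZ, hY, hcard⟩ := exists_isOneCell_of_surj
      (Z := {p : Fin (n + 2) → M | Fin.init p ∈ B ∧ f (Fin.init p) < p (Fin.last _) ∧
        p (Fin.last _) < g (Fin.init p)}) fun a => by
      obtain ⟨z, hz, rfl⟩ := hsurj a
      obtain ⟨y, hy⟩ := Set.nonempty_of_ncard_ne_zero (s := Set.Ioo (f z) (g z))
        (by have := (h1 hα z hz).1; omega)
      exact ⟨Fin.snoc z y, by simpa using ⟨hz, hy⟩, by rw [← Fin.castSucc_zero, Fin.snoc_castSucc]⟩
    refine Or.inr ⟨hα, _, hcell, ht.band ⟨z, hz⟩ fun x hx => (h1 hα x hx).1, Y, hY, hYZ, ?_⟩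
    refine (abs_ncard_band_sub_le hC fun x hx => (h1 hα x hx).2).trans ?_
    have hpos : (0 : ℝ) < Nat.card M := by exact_mod_cast Nat.card_pos
    have hle : (B.ncard : ℝ) ≤ (Nat.card M : ℝ) ^ (∑ j, (ι j : ℕ)) := by
      exact_mod_cast hB.ncard_le
    have hexp : (((∑ j, ((Fin.snoc ι 1 : Fin (n + 2) → Fin 2) j : ℕ) : ℕ) : ℝ) - 1 / 2)
        = ((∑ j, (ι j : ℕ) : ℕ) : ℝ) + 1 / 2 := by
      rw [Fin.sum_univ_castSucc]
      simp only [Fin.snoc_castSucc, Fin.snoc_last, Fin.val_one, Nat.cast_add, Nat.cast_one]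
      ring
    rw [hexp, hcard, Real.rpow_add hpos, Real.rpow_natCast]
    calc (B.ncard : ℝ) * (C * (Nat.card M : ℝ) ^ (1 / 2 : ℝ))
        ≤ (Nat.card M : ℝ) ^ (∑ j, (ι j : ℕ)) * (C * (Nat.card M : ℝ) ^ (1 / 2 : ℝ)) := by gcongr
      _ = _ := by ring

end Density

/-- Makes a listing with repetitions disjoint, by assigning each element to its first occurrence. -/
theorem existsUnique_first {ι : Type*} [LinearOrder ι] [Finite ι] {p : ι → Prop}
    (h : ∃ i, p i) : ∃! i, p i ∧ ∀ j < i, ¬ p j := by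
  obtain ⟨i, hi, hmin⟩ := Set.exists_min_image {i | p i} id (Set.toFinite _) h
  refine ⟨i, ⟨hi, fun j hj hpj => (hmin j hpj).not_gt hj⟩, ?_⟩
  rintro j ⟨hpj, hj⟩
  exact le_antisymm (not_lt.1 fun h => hj i h hi) (hmin j hpj)

/-! ### Small structures and the induction on the number of variables -/

variable {Δ : MeasureSystem L} {𝒞 : Set (FinOrdStructure.{u, v, w} L lt)}

/-- Structures of bounded size can be decomposed into points. -/
theorem HasUnifCellDecomposition.of_large {n : ℕ}
    {S : ∀ M : FinOrdStructure.{u, v, w} L lt, (γ → M) → Set (Fin (n + 1) → M)} (K : ℕ)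
    (h : HasUnifCellDecomposition Δ {M ∈ 𝒞 | K < Nat.card M} S) :
    HasUnifCellDecomposition Δ 𝒞 S := by
  obtain ⟨κ, _, α, C, Z, hC, hα, hZ, hdec⟩ := h
  have hsurj : UnifDef fun (M : FinOrdStructure.{u, v, w} L lt) (x : γ ⊕ Fin K → M) =>
      ∀ y, ∃ i, y = (x ∘ Sum.inr) i :=
    UnifDef.forall_elem (UnifDef.finite_exists fun i =>
      UnifDef.eq_var (γ := (γ ⊕ Fin K) ⊕ Unit) (Sum.inr ()) (Sum.inl (Sum.inr i)))
  -- A definable list of all elements of `M` when `|M| ≤ K`. For larger `M` its values are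
  -- irrelevant, since the cells built from it are made empty.
  obtain ⟨F, hF, hFsurj⟩ := UnifDef.exists_choice (γ := γ) (ι := Fin K)
    (P := fun M _ z => ∀ y, ∃ i, y = z i) hsurj
  have hsmall : UnifDef fun (M : FinOrdStructure.{u, v, w} L lt) (_ : γ ⊕ Fin (n + 1) → M) =>
      {_y : M | True}.ncard ≤ K := UnifDef.ncard_le (P := fun _ _ _ => True) (UnifDef.const True) K
  have hsmall_iff : ∀ M : FinOrdStructure.{u, v, w} L lt,
      {_y : M | True}.ncard ≤ K ↔ Nat.card M ≤ K := fun M => by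
    rw [Set.ofPred_true, Set.ncard_univ]
  refine ⟨κ ⊕ (Fin (n + 1) → Fin K), inferInstance, Sum.elim α fun _ => 0, C + 1,
    Sum.elim (fun k M a => {x | x ∈ Z k M a ∧ ¬ {_y : M | True}.ncard ≤ K})
      (fun σ M a => {x | {_y : M | True}.ncard ≤ K ∧
        ∀ j, x j = F (σ j) M a ∧ ∀ i < σ j, ¬ x j = F i M a}), by linarith, ?_, ?_, ?_⟩
  · rintro (k | σ)
    · exact hα k
    · simp
  · rintro (k | σ)
    · exact (hZ k).and hsmall.not
    · exact hsmall.and (UnifDef.finite_forall fun j =>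
        ((UnifDefFun.var (Sum.inr j)).rel_eq ((hF _).comap Sum.inl)).and
          (UnifDef.finite_forall fun i => (UnifDef.const _).imp
            ((UnifDefFun.var (Sum.inr j)).rel_eq ((hF _).comap Sum.inl)).not))
  · intro M hM a
    by_cases hK : Nat.card M ≤ K
    · have hK' := (hsmall_iff M).2 hK
      constructor
      · intro x
        have hcov := hFsurj M a (exists_fin_range_superset Set.finite_univ
          ((Set.ncard_univ M).trans_le hK) |>.imp fun z hz y => hz y trivial)
        choose σ hσ hσu using fun j => existsUnique_first (hcov (x j))
        refine ⟨.inr σ, ⟨hK', hσ⟩, ?_⟩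
        rintro (k | τ) hk
        · exact absurd hK' hk.2
        · rw [funext fun j => hσu j _ (hk.2 j)]
      · rintro (k | σ) ⟨x, hx⟩
        · exact absurd hK' hx.2
        · have hsing : {x : Fin (n + 1) → M | {_y : M | True}.ncard ≤ K ∧
              ∀ j, x j = F (σ j) M a ∧ ∀ i < σ j, ¬ x j = F i M a} = {x} := by
            refine Set.eq_singleton_iff_unique_mem.2 ⟨hx, fun y hy => funext fun j => ?_⟩
            rw [(hy.2 j).1, (hx.2 j).1]
          simp only [Sum.elim_inr]
          rw [hsing]
          exact (hasCellDensity_singleton _ _).mono (by linarith)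
    · have hK' := mt (hsmall_iff M).1 hK
      obtain ⟨hpart, hcell⟩ := hdec M ⟨hM, not_le.1 hK⟩ a
      constructor
      · intro x
        obtain ⟨k, hk, hku⟩ := hpart x
        refine ⟨.inl k, ⟨hk, hK'⟩, ?_⟩
        rintro (k' | τ) hk'
        · rw [hku k' hk'.1]
        · exact absurd hk'.1 hK'
      · rintro (k | σ) ⟨x, hx⟩
        · have heq : {x | x ∈ Z k M a ∧ ¬ {_y : M | True}.ncard ≤ K} = Z k M a :=
            Set.ext fun y => and_iff_left hK'
          simp only [Sum.elim_inl]
          rw [heq]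
          exact (hcell k ⟨x, hx.1⟩).mono (by linarith)
        · exact absurd hx.1 hK'

theorem ncard_fin_one {M : Type*} (A : Set M) : {p : Fin 1 → M | p 0 ∈ A}.ncard = A.ncard := by
  have hinj : Function.Injective fun (y : M) (_ : Fin 1) => y := fun y z h => congrFun h 0
  rw [← Set.ncard_image_of_injective _ hinj]
  congr 1
  ext p
  constructor
  · exact fun hp => ⟨p 0, hp, funext fun i => by rw [Fin.fin_one_eq_zero i]⟩
  · rintro ⟨y, hy, rfl⟩
    exact hy

theorem hasUnifCellDecomposition_one (hΔ : Δ.Witnesses 𝒞) [Finite γ]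
    {S : ∀ M : FinOrdStructure.{u, v, w} L lt, (γ → M) → Set (Fin 1 → M)}
    (hS : UnifDef fun M (x : γ ⊕ Fin 1 → M) => x ∘ Sum.inr ∈ S M (x ∘ Sum.inl)) :
    HasUnifCellDecomposition Δ 𝒞 S := by
  obtain ⟨H, T, _, _, α, C, K, h, f, g, hC, hα, hh, hf, hg, hpart⟩ := exists_fibre_partition hΔ
    (S := fun M x y => (fun _ => y) ∈ S M x) (hS.comap (Sum.map id fun _ => ()))
  refine HasUnifCellDecomposition.of_large K ⟨H ⊕ T, inferInstance, Sum.elim (fun _ => 0) α, C + 1,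
    Sum.elim (fun l M a => {p | p 0 = h l M a}) (fun t M a => {p | p 0 ∈ Set.Ioo (f t M a) (g t M a)}),
    by linarith, ?_, ?_, ?_⟩
  · rintro (l | t)
    · simp
    · exact hα t
  · rintro (l | t)
    · exact (UnifDefFun.var (Sum.inr 0)).rel_eq ((hh l).comap Sum.inl)
    · exact (UnifDefFun.var (Sum.inr 0)).mem_Ioo ((hf t).comap Sum.inl) ((hg t).comap Sum.inl)
  · rintro M ⟨hM, hK⟩ a
    obtain ⟨hp, hint⟩ := hpart M hM hK a
    constructor
    · intro x
      obtain ⟨i, hi, hiu⟩ := hp (x 0)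
      refine ⟨i, ?_, fun j hj => hiu j ?_⟩
      · rcases i with l | t <;> exact hi
      · rcases j with l | t <;> exact hj
    · rintro (l | t) ⟨x, hx⟩
      · have heq : {p : Fin 1 → M | p 0 = h l M a} = {x} := by
          refine Set.eq_singleton_iff_unique_mem.2 ⟨hx, fun y hy => funext fun i => ?_⟩
          rw [Fin.fin_one_eq_zero i]
          exact Eq.trans hy (Eq.symm hx)
        simp only [Sum.elim_inl]
        rw [heq]
        exact (hasCellDensity_singleton _ _).mono (by linarith)
      · simp only [Sum.elim_inr]
        have hne : IsOpenInterval (Set.Ioo (f t M a) (g t M a)) := ⟨⟨x 0, hx⟩, Or.inl ⟨_, _, rfl⟩⟩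
        have hinter : S M a ∩ {p | p 0 ∈ Set.Ioo (f t M a) (g t M a)} =
            {p | p 0 ∈ {y | (fun _ => y) ∈ S M a} ∩ Set.Ioo (f t M a) (g t M a)} := by
          ext p
          have : (fun _ : Fin 1 => p 0) = p := funext fun i => by rw [Fin.fin_one_eq_zero i]
          simp [this]
        by_cases h0 : α t = 0
        · refine Or.inl ⟨h0, ⟨_, IsCell.interval _ hne⟩, ?_⟩
          have : {y | (fun _ => y) ∈ S M a} ∩ Set.Ioo (f t M a) (g t M a) = ∅ := by
            rw [Set.eq_empty_iff_forall_notMem]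
            exact fun y hy => (hint t).2.1 h0 y hy.2 hy.1
          rw [hinter, ncard_fin_one, this]
          simp only [Set.ncard_empty, Nat.cast_zero]
          linarith
        -- The interval is its own 1-cell and its type has sum `1`, so the exponent is the `1/2` of
        -- the fibre estimate.
        · refine Or.inr ⟨h0, _, IsCell.interval _ hne, fun j _ hj => absurd (by omega) hj,
            {p : Fin 1 → M | p 0 ∈ Set.Ioo (f t M a) (g t M a)},
            ⟨0, _, hne, fun p hp => hp, fun p _ q _ hpq => funext fun i => ?_,
              fun y hy => ⟨fun _ => y, hy, rfl⟩⟩, subset_rfl, ?_⟩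
          · rw [Fin.fin_one_eq_zero i]
            exact hpq
          · rw [hinter, ncard_fin_one, ncard_fin_one]
            refine ((hint t).2.2 h0).2.trans ?_
            have : (((∑ _j : Fin 1, ((1 : Fin 2) : ℕ) : ℕ) : ℝ) - 1 / 2) = 1 / 2 := by
              norm_num
            rw [this]
            gcongr
            linarith

/-- Each point label is treated by the induction hypothesis for the trace of `S` on the graph of its
function. Interval labels use only the boxes, because their density does not vary with the base
point. -/
theorem hasUnifCellDecomposition_succ (hΔ : Δ.Witnesses 𝒞) [Finite γ] {n : ℕ}
    (ih : ∀ {S : ∀ M : FinOrdStructure.{u, v, w} L lt, (γ → M) → Set (Fin (n + 1) → M)},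
      (UnifDef fun M (x : γ ⊕ Fin (n + 1) → M) => x ∘ Sum.inr ∈ S M (x ∘ Sum.inl)) →
        HasUnifCellDecomposition Δ 𝒞 S)
    {S : ∀ M : FinOrdStructure.{u, v, w} L lt, (γ → M) → Set (Fin (n + 2) → M)}
    (hS : UnifDef fun M (x : γ ⊕ Fin (n + 2) → M) => x ∘ Sum.inr ∈ S M (x ∘ Sum.inl)) :
    HasUnifCellDecomposition Δ 𝒞 S := by
  have hS₁ : UnifDef fun M (x : (γ ⊕ Fin (n + 1)) ⊕ Unit → M) =>
      (Fin.snoc (x ∘ Sum.inl ∘ Sum.inr) (x (Sum.inr ())) : Fin (n + 2) → M) ∈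
        S M (x ∘ Sum.inl ∘ Sum.inl) := by
    refine (hS.comap (γ := (γ ⊕ Fin (n + 1)) ⊕ Unit) (Sum.elim (Sum.inl ∘ Sum.inl)
      (Fin.snoc (α := fun _ => (γ ⊕ Fin (n + 1)) ⊕ Unit) (Sum.inl ∘ Sum.inr) (Sum.inr ())))).congr
        fun M x => ?_
    rw [← Fin.comp_snoc]
    rfl
  obtain ⟨H, T, _, _, v, C, K, h, f, g, hC, hv, hh, hf, hg, hpart⟩ := exists_fibre_partition hΔ
    (S := fun M (x : γ ⊕ Fin (n + 1) → M) y =>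
      (Fin.snoc (x ∘ Sum.inr) y : Fin (n + 2) → M) ∈ S M (x ∘ Sum.inl)) hS₁
  have hSl : ∀ l, UnifDef fun M (x : γ ⊕ Fin (n + 1) → M) => x ∘ Sum.inr ∈
      {y | (Fin.snoc y (h l M (Sum.elim (x ∘ Sum.inl) y)) : Fin (n + 2) → M) ∈
        S M (x ∘ Sum.inl)} := by
    intro l
    refine (UnifDef.subst hS (γ := γ ⊕ Fin (n + 1)) (F := Sum.elim (fun i _ x => x (Sum.inl i))
      (Fin.lastCases (h l) fun i _ x => x (Sum.inr i))) ?_).congr fun M x => ?_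
    · rintro (i | i)
      · exact UnifDefFun.var _
      · induction i using Fin.lastCases with
        | last => simpa using hh l
        | cast i => simpa using UnifDefFun.var _
    · rw [Set.mem_ofPred_eq, Sum.elim_comp_inl_inr, iff_iff_eq]
      congr 1
      ext i
      induction i using Fin.lastCases with
      | last => simp
      | cast i => simp
  choose κ hκ α Cl W hCl hα hW hdec using fun l => ih (S := fun M a =>
    {y | (Fin.snoc y (h l M (Sum.elim a y)) : Fin (n + 2) → M) ∈ S M a}) (hSl l)
  obtain ⟨κB, _, B, hB, hbox⟩ := exists_box_decomposition (lt := lt) Δ n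
  have := Fintype.ofFinite H
  have hCsum : ∀ l, Cl l ≤ C + ∑ l, Cl l := fun l => by
    have := Finset.single_le_sum (f := Cl) (fun l _ => (hCl l).le) (Finset.mem_univ l)
    linarith
  have hCsum' : C ≤ C + ∑ l, Cl l := by
    have := Finset.sum_nonneg (s := Finset.univ) fun l _ => (hCl l).le
    linarith
  -- The fibre partition needs `|M| > K`, the boxes need `|M| ≥ 4`.
  refine HasUnifCellDecomposition.of_large (max K 4) ⟨(Σ l, κ l) ⊕ (κB × T), inferInstance,
    Sum.elim (fun k => α k.1 k.2) fun k => v k.2, C + ∑ l, Cl l,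
    Sum.elim (fun k M a => {p | Fin.init p ∈ W k.1 k.2 M a ∧
        p (Fin.last _) = h k.1 M (Sum.elim a (Fin.init p))})
      fun k M a => {p | Fin.init p ∈ B k.1 M ∧ f k.2 M (Sum.elim a (Fin.init p)) < p (Fin.last _) ∧
        p (Fin.last _) < g k.2 M (Sum.elim a (Fin.init p))}, by linarith, ?_, ?_, ?_⟩
  · rintro (k | k)
    · exact hα _ _
    · exact hv _
  · have hcomp : ∀ {F : ∀ M : FinOrdStructure.{u, v, w} L lt, (γ ⊕ Fin (n + 1) → M) → M},
        UnifDefFun F → UnifDefFun fun M (x : γ ⊕ Fin (n + 2) → M) =>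
          F M (Sum.elim (x ∘ Sum.inl) (Fin.init (x ∘ Sum.inr))) := by
      intro F hF
      have := hF.comap (γ := γ ⊕ Fin (n + 2)) (Sum.map id Fin.castSucc)
      refine UnifDef.congr this fun M x => ?_
      have hx : (x ∘ Sum.inl) ∘ Sum.map id Fin.castSucc =
          Sum.elim ((x ∘ Sum.inl) ∘ Sum.inl) (Fin.init ((x ∘ Sum.inl) ∘ Sum.inr)) := by
        ext (i | i) <;> rfl
      beta_reduce
      rw [← hx]
    rintro (⟨l, k⟩ | ⟨b, t⟩)
    · exact ((hW l k).comap (Sum.map id Fin.castSucc)).and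
        ((UnifDefFun.var (Sum.inr (Fin.last _))).rel_eq (hcomp (hh l)))
    · exact ((hB b).comap (Sum.inr ∘ Fin.castSucc)).and
        (((hcomp (hf t)).rel_lt (UnifDefFun.var (Sum.inr (Fin.last _)))).and
          ((UnifDefFun.var (Sum.inr (Fin.last _))).rel_lt (hcomp (hg t))))
  · rintro M ⟨hM, hcard⟩ a
    rw [max_lt_iff] at hcard
    have hfib := fun x : Fin (n + 1) → M => hpart M hM hcard.1 (Sum.elim a x)
    simp only [Sum.elim_comp_inl, Sum.elim_comp_inr] at hfib
    obtain ⟨hbpart, hbcell⟩ := hbox M hcard.2.le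
    constructor
    · intro p
      obtain ⟨i, hi, hiu⟩ := (hfib (Fin.init p)).1 (p (Fin.last _))
      rcases i with l | t
      · obtain ⟨k, hk, hku⟩ := (hdec l M hM a).1 (Fin.init p)
        refine ⟨.inl ⟨l, k⟩, ⟨hk, hi⟩, ?_⟩
        rintro (⟨l', k'⟩ | ⟨b, t⟩) hk'
        · obtain rfl := Sum.inl_injective (hiu (.inl l') hk'.2)
          rw [hku k' hk'.1]
        · exact absurd (hiu (.inr t) hk'.2) (by simp)
      · obtain ⟨b, hb, hbu⟩ := hbpart (Fin.init p)
        refine ⟨.inr (b, t), ⟨hb, hi⟩, ?_⟩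
        rintro (⟨l', k'⟩ | ⟨b', t'⟩) hk'
        · exact absurd (hiu (.inl l') hk'.2) (by simp)
        · obtain rfl := Sum.inr_injective (hiu (.inr t') hk'.2)
          rw [hbu b' hk'.1]
    · rintro (⟨l, k⟩ | ⟨b, t⟩) ⟨p, hp⟩
      · refine HasCellDensity.mono ?_ (hCsum l)
        exact HasCellDensity.graph ((hdec l M hM a).2 k ⟨_, hp.1⟩)
      · obtain ⟨ι, hι, ht, hsurj⟩ := hbcell b
        refine HasCellDensity.mono ?_ hCsum'
        exact hasCellDensity_band hι ht hsurj (f := fun x => f t M (Sum.elim a x))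
          (g := fun x => g t M (Sum.elim a x)) (fun x _ => ((hfib x).2 t).1) hC.le
          (fun h0 x _ => ((hfib x).2 t).2.1 h0) (fun h0 x _ => ((hfib x).2 t).2.2 h0)

/-- Every uniformly definable family in an `𝒪`-asymptotic class has a uniformly definable cell
decomposition into cells of fixed densities. -/
theorem hasUnifCellDecomposition (hΔ : Δ.Witnesses 𝒞) [Finite γ] (n : ℕ)
    {S : ∀ M : FinOrdStructure.{u, v, w} L lt, (γ → M) → Set (Fin (n + 1) → M)}
    (hS : UnifDef fun M (x : γ ⊕ Fin (n + 1) → M) => x ∘ Sum.inr ∈ S M (x ∘ Sum.inl)) :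
    HasUnifCellDecomposition Δ 𝒞 S := by
  induction n with
  | zero => exact hasUnifCellDecomposition_one hΔ hS
  | succ n ih => exact hasUnifCellDecomposition_succ hΔ ih hS

/-- The dimension of a cell and a largest `1`-cell in it satisfy the density estimate. -/
theorem HasCellDensity.cellDim {M : Type w} [L.Structure M] [LinearOrder M] [Finite M] {n : ℕ}
    {S Z : Set (Fin n → M)} {C α : ℝ} (hC : 0 ≤ C) (h : HasCellDensity Δ S C α Z) :
    (α = 0 ∧ ((S ∩ Z).ncard : ℝ) ≤ C) ∨
    (α ≠ 0 ∧ ∃ Y : Set (Fin n → M), IsMaxOneCell Y Z ∧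
      |((S ∩ Z).ncard : ℝ) - α * (Z.ncard : ℝ)|
        ≤ C * (Y.ncard : ℝ) ^ ((cellDim Δ Z : ℝ) - 1 / 2)) := by
  rcases h with ⟨h0, -, h⟩ | ⟨h0, ι, hι, ht, Y, hY, hYZ, h⟩
  · exact Or.inl ⟨h0, h⟩
  · obtain ⟨Y', hY', hle⟩ := exists_isMaxOneCell hY hYZ
    refine Or.inr ⟨h0, Y', hY', h.trans ?_⟩
    rw [cellDim_eq_of_thick hι ht]
    -- The exponent is at least `1/2`, so passing from `Y` to a largest 1-cell only increases the
    -- bound.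
    have h1 : (1 : ℝ) ≤ ((∑ j, (ι j : ℕ) : ℕ) : ℝ) := by exact_mod_cast hι.one_le_sum
    have h2 : (Y.ncard : ℝ) ≤ (Y'.ncard : ℝ) := by exact_mod_cast hle
    have h3 : (0 : ℝ) ≤ ((∑ j, (ι j : ℕ) : ℕ) : ℝ) - 1 / 2 := by linarith
    gcongr

end CellDecomposition

theorem theorem2 {L : FirstOrder.Language.{u, v}} {lt : L.Relations 2}
    (𝒞 : Set (FinOrdStructure.{u, v, w} L lt))
    (Δ : MeasureSystem L) (hΔ : Δ.Witnesses 𝒞)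
    (n m : ℕ) (hn : 1 ≤ n) (φ : L.Formula (Fin n ⊕ Fin m)) :
    ∃ (C : ℝ) (k : ℕ) (D : Finset (Fin k → ℝ))
      (r : (Fin k → ℝ) → ℕ)
      (ζ : ∀ α : Fin k → ℝ, Fin k → L.Formula (Fin n ⊕ (Fin m ⊕ Fin (r α))))
      (ψ : ∀ α : Fin k → ℝ, L.Formula (Fin m ⊕ Fin (r α))),
      0 < C ∧ (∀ α ∈ D, ∀ i, α i ∈ Set.Icc (0 : ℝ) 1) ∧
      (∀ M ∈ 𝒞, ∀ a : Fin m → M, ∃ α ∈ D, ∃ d : Fin (r α) → M,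
        IsCellDecomposition Δ (fun i => defSet M (ζ α i) (Sum.elim a d)) ∧
        CellwiseMeasure Δ (defSet M φ a) C α (fun i => defSet M (ζ α i) (Sum.elim a d))) ∧
      (∀ α ∈ D, ∀ M ∈ 𝒞, ∀ (a : Fin m → M) (d : Fin (r α) → M),
        (ψ α).Realize (Sum.elim a d) ↔
          IsCellDecomposition Δ (fun i => defSet M (ζ α i) (Sum.elim a d)) ∧
          CellwiseMeasure Δ (defSet M φ a) C α (fun i => defSet M (ζ α i) (Sum.elim a d))) := by
  obtain ⟨n, rfl⟩ := Nat.exists_eq_add_of_le' hn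
  have hφ : UnifDef fun (M : FinOrdStructure.{u, v, w} L lt) (x : Fin m ⊕ Fin (n + 1) → M) =>
      x ∘ Sum.inr ∈ defSet M φ (x ∘ Sum.inl) := by
    refine ((UnifDef.realize φ).comap (Sum.elim Sum.inr Sum.inl)).congr fun M x => ?_
    rw [defSet, Set.mem_ofPred_eq, iff_iff_eq]
    congr 1
    ext (i | i) <;> rfl
  obtain ⟨κ, _, α, C, Z, hC, hα, hZ, hdec⟩ :=
    hasUnifCellDecomposition hΔ n (S := fun M a => defSet M φ a) hφ
  obtain ⟨k, ⟨e⟩⟩ := Finite.exists_equiv_fin κ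
  choose θ hθ using hZ
  let ζ : Fin k → L.Formula (Fin (n + 1) ⊕ (Fin m ⊕ Fin 0)) := fun i =>
    (θ (e.symm i)).relabel (Sum.elim (Sum.inr ∘ Sum.inl) Sum.inl)
  have hζ : ∀ (M : FinOrdStructure.{u, v, w} L lt) (a : Fin m → M) (d : Fin 0 → M) i,
      defSet M (ζ i) (Sum.elim a d) = Z (e.symm i) M a := by
    intro M a d i
    ext x
    rw [defSet, Set.mem_ofPred_eq, FirstOrder.Language.Formula.realize_relabel, hθ]
    rfl
  have hmain : ∀ M ∈ 𝒞, ∀ (a : Fin m → M) (d : Fin 0 → M),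
      IsCellDecomposition Δ (fun i => defSet M (ζ i) (Sum.elim a d)) ∧
      CellwiseMeasure Δ (defSet M φ a) C (α ∘ e.symm)
        (fun i => defSet M (ζ i) (Sum.elim a d)) := by
    intro M hM a d
    obtain ⟨hpart, hcell⟩ := hdec M hM a
    simp only [hζ]
    refine ⟨⟨fun i hi => ?_, fun i j hij => ?_, ?_⟩, fun i hi => (hcell _ hi).cellDim hC.le⟩
    · rcases hcell _ hi with ⟨-, hι, -⟩ | ⟨-, ι, hι, -⟩
      · exact hι
      · exact ⟨ι, hι⟩
    · rw [Set.disjoint_left]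
      exact fun x hxi hxj => hij (e.symm.injective ((hpart x).unique hxi hxj))
    · refine Set.eq_univ_of_forall fun x => ?_
      obtain ⟨k, hk, -⟩ := hpart x
      exact Set.mem_iUnion.2 ⟨e k, by simpa using hk⟩
  -- The densities are attached to the cells, and the cells are defined from `a` alone: one tuple `α`
  -- and the empty tuple `d` suffice, and the decomposition condition always holds.
  refine ⟨C, k, {α ∘ e.symm}, fun _ => 0, fun _ => ζ, fun _ => ⊤, hC, ?_, ?_, ?_⟩
  · intro β hβ i
    rw [Finset.mem_singleton.1 hβ]
    exact hα _
  · exact fun M hM a => ⟨_, Finset.mem_singleton_self _, Fin.elim0, hmain M hM a _⟩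
  · intro β hβ M hM a d
    rw [Finset.mem_singleton.1 hβ]
    exact iff_of_true (by simp) (hmain M hM a d)
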